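/- Let $n\ge 1$ and let $P=\{x\in\mathbb R^n : \lambda_r(x)>c_r \text{ for all } r\}$ be a bounded Delzant polytope: the $\lambda_r$ are integral linear forms, each inequality defines a facet, and at each vertex of $\overline P$ the forms $\lambda_r$ of the facets through it form a $\mathbb Z$-basis of the dual lattice. Let $X$ be the toric manifold of $P$, with compact torus $T$. Suppose that $P$ is the polytope of $X$ as a toric Fano manifold polarised by $K_X^{-1}$, that is, there is a point $\nu_0\in P$ (the centre) with $\lambda_r(\nu_0)-c_r=1$ for every $r$. Let $\Gamma$ be a finite group of affine transformations $x\mapsto Ax+b$, with $A\in GL(n,\mathbb Z)$ and $b\in\mathbb R^n$, which preserve $P$, and suppose that $\nu_0$ is the only point of $P$ fixed by $\Gamma$. Through its linear parts $\Gamma$ acts on $X$, and together with $T$ it generates a compact group $\hat T$ of holomorphic automorphisms of $X$, an extension of $\Gamma$ by $T$. Let $\omega_0$ be any $\hat T$-invariant Kähler metric on $X$ in the class $-c_1(K_X)$, normalised so that $\omega_0$ is $i$ times the curvature of a Hermitian metric on $K_X^{-1}$, and let $d\mu_0$ be its volume form. Let $\mathcal P$ be the set of smooth $\hat T$-invariant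 functions $\psi$ on $X$ with $\omega_0+i\partial\overline\partial\psi>0$ and $\max_X\psi=0$. Then the $\hat T$-equivariant $\alpha$-invariant of $X$ equals $1$: $$\alpha_{\hat T}(X)=\sup\Big\{\beta\in\mathbb R : \text{there is } C_\beta\in\mathbb R \text{ with } \int_X e^{-\beta\psi}\,d\mu_0\le C_\beta \text{ for all } \psi\in\mathcal P\Big\}=1 .$$ -/

import Mathlib

open MeasureTheory Topology
open scoped ContDiff ComplexOrder Matrix

noncomputable section

/-! ### Complex geometry in holomorphic coordinates

A compact complex manifold `X` of dimension `n` is handled through a family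
`c : S → (Fin n → ℂ) → X` of holomorphic parametrisations (inverse charts, all defined on `ℂⁿ`)
whose images cover `X`. -/

namespace ToricAlpha

section ComplexGeometry

variable {n : ℕ} {X S : Type*}

/-- The Wirtinger derivative `∂f/∂z_i`. -/
def dz (f : (Fin n → ℂ) → ℂ) (i : Fin n) (z : Fin n → ℂ) : ℂ :=
  (fderiv ℝ f z (Pi.single i 1) - Complex.I * fderiv ℝ f z (Pi.single i Complex.I)) / 2

/-- The Wirtinger derivative `∂f/∂z̄_i`. -/
def dzbar (f : (Fin n → ℂ) → ℂ) (i : Fin n) (z : Fin n → ℂ) : ℂ :=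
  (fderiv ℝ f z (Pi.single i 1) + Complex.I * fderiv ℝ f z (Pi.single i Complex.I)) / 2

/-- The matrix `∂²f/∂z_i∂z̄_j`, i.e. the coefficients of `i∂∂̄f = i ∑ f_{ij̄} dz_i ∧ dz̄_j`. -/
def complexHessian (f : (Fin n → ℂ) → ℝ) (z : Fin n → ℂ) : Matrix (Fin n) (Fin n) ℂ :=
  Matrix.of fun i j => dz (fun w => dzbar (fun v => (f v : ℂ)) j w) i z

/-- The complex Jacobian matrix `∂F_k/∂z_i`. -/
def jacobian (F : (Fin n → ℂ) → (Fin n → ℂ)) (z : Fin n → ℂ) : Matrix (Fin n) (Fin n) ℂ :=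
  Matrix.of fun k i => fderiv ℂ F z (Pi.single i 1) k

/-- `F` is the expression, near `z`, of the map `g : X → X` in the coordinates `s` (source) and
`t` (target). For `g = id` it is a change of coordinates. -/
def IsLocalExpr (c : S → (Fin n → ℂ) → X) (g : X → X) (s t : S)
    (F : (Fin n → ℂ) → (Fin n → ℂ)) (z : Fin n → ℂ) : Prop :=
  DifferentiableAt ℂ F z ∧ ∀ᶠ w in 𝓝 z, c t (F w) = g (c s w)

/-- Smooth real functions on `X`. -/
def IsSmooth (c : S → (Fin n → ℂ) → X) (ψ : X → ℝ) : Prop :=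
  ∀ s, ContDiff ℝ ∞ fun z => ψ (c s z)

/-- For a family `H s` of coefficient matrices of `(1,1)`-forms `i ∑ H_{ij̄} dz_i ∧ dz̄_j` in the
coordinates `s`: the pull-back of the form by `g : X → X` is the form itself. For `g = id` this
says that the local forms agree on overlaps. -/
def PullbackEq (c : S → (Fin n → ℂ) → X) (H : S → (Fin n → ℂ) → Matrix (Fin n) (Fin n) ℂ)
    (g : X → X) : Prop :=
  ∀ (s t : S) (F : (Fin n → ℂ) → (Fin n → ℂ)) (z : Fin n → ℂ), IsLocalExpr c g s t F z →
    H s z = (jacobian F z)ᵀ * H t (F z) * (jacobian F z).map (starRingEnd ℂ)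

/-- A Kähler metric on `X`, with Kähler form `ω = i ∑ g_{ij̄} dz_i ∧ dz̄_j` in each chart. -/
structure KahlerMetric (c : S → (Fin n → ℂ) → X) where
  /-- the matrix `g_{ij̄}` in the coordinates `s` -/
  coeff : S → (Fin n → ℂ) → Matrix (Fin n) (Fin n) ℂ
  smooth : ∀ s i j, ContDiff ℝ ∞ fun z => coeff s z i j
  posDef : ∀ s z, (coeff s z).PosDef
  /-- `dω = 0` -/
  closed : ∀ s z i j k,
    dz (fun w => coeff s w i j) k z = dz (fun w => coeff s w k j) i z
  compatible : PullbackEq c coeff id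

/-- `ω₀` is invariant under the group `G` of transformations of `X`. -/
def KahlerMetric.IsInvariant {c : S → (Fin n → ℂ) → X} (ω₀ : KahlerMetric c)
    (G : Subgroup (Equiv.Perm X)) : Prop :=
  ∀ g ∈ G, PullbackEq c ω₀.coeff g

/-- A smooth Hermitian metric on the anticanonical bundle `K_X⁻¹ = Λⁿ TX`. -/
structure AnticanonicalMetric (c : S → (Fin n → ℂ) → X) where
  /-- the function `|∂/∂z_1 ∧ ⋯ ∧ ∂/∂z_n|²` in the coordinates `s` -/
  normSq : S → (Fin n → ℂ) → ℝ
  smooth : ∀ s, ContDiff ℝ ∞ (normSq s)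
  pos : ∀ s z, 0 < normSq s z
  compatible : ∀ (s t : S) (F : (Fin n → ℂ) → (Fin n → ℂ)) (z : Fin n → ℂ),
    IsLocalExpr c id s t F z → normSq s z = ‖(jacobian F z).det‖ ^ 2 * normSq t (F z)

/-- `ω₀` lies in the class `-c₁(K_X)` (with the normalisation in which the class is that of the
curvature forms): there is a Hermitian metric on `K_X⁻¹` whose curvature is `-iω₀`, that is
`ω₀ = -i∂∂̄ log |∂/∂z_1 ∧ ⋯ ∧ ∂/∂z_n|²`. -/
def KahlerMetric.IsAnticanonical {c : S → (Fin n → ℂ) → X} (ω₀ : KahlerMetric c) : Prop :=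
  ∃ h : AnticanonicalMetric c, ∀ s z,
    ω₀.coeff s z = -complexHessian (fun w => Real.log (h.normSq s w)) z

/-- The Riemannian volume measure `ω₀ⁿ/n! = 2ⁿ det(g_{ij̄}) dLebesgue`: the smallest measure on `X`
which dominates its expression in each chart. -/
def KahlerMetric.volumeMeasure [MeasurableSpace X] {c : S → (Fin n → ℂ) → X}
    (ω₀ : KahlerMetric c) :
    Measure X :=
  ⨆ s, Measure.map (c s)
    ((MeasureTheory.volume : Measure (Fin n → ℂ)).withDensity fun z =>
      ENNReal.ofReal (2 ^ n * (ω₀.coeff s z).det.re))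

/-- The `G`-invariant Kähler potentials `ψ` with `ω₀ + i∂∂̄ψ > 0` and `max ψ = 0`. -/
def normalizedPotentials {c : S → (Fin n → ℂ) → X} (ω₀ : KahlerMetric c)
    (G : Subgroup (Equiv.Perm X)) : Set (X → ℝ) :=
  {ψ | IsSmooth c ψ ∧ (∀ g ∈ G, ∀ x, ψ (g x) = ψ x) ∧
    (∀ s z, (ω₀.coeff s z + complexHessian (fun w => ψ (c s w)) z).PosDef) ∧
    IsGreatest (Set.range ψ) 0}

/-- Tian's `α`-invariant: the supremum (in the extended reals) of the real numbers `β` for which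
`∫_X exp(-βψ) dμ₀` is bounded uniformly over the normalised `G`-invariant potentials `ψ`. -/
def alphaInvariant [MeasurableSpace X] {c : S → (Fin n → ℂ) → X} (ω₀ : KahlerMetric c)
    (G : Subgroup (Equiv.Perm X)) : EReal :=
  sSup ((fun β : ℝ => (β : EReal)) '' {β : ℝ | ∃ C : ℝ, ∀ ψ ∈ normalizedPotentials ω₀ G,
    ∫⁻ x, ENNReal.ofReal (Real.exp (-β * ψ x)) ∂ω₀.volumeMeasure ≤ ENNReal.ofReal C})

end ComplexGeometry

/-! ### Delzant polytopes and their toric manifolds -/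

/-- The value at `x ∈ ℝⁿ` of the integral linear form `l`. -/
def pair {n : ℕ} (l : Fin n → ℤ) (x : Fin n → ℝ) : ℝ := ∑ i, (l i : ℝ) * x i

/-- A Delzant polytope `{x | λ_r(x) > c_r for all r}` in `ℝⁿ`, with facets indexed by `ι`. -/
structure DelzantPolytope (n : ℕ) (ι : Type*) where
  /-- the linear forms `λ_r` -/
  normal : ι → Fin n → ℤ
  /-- the constants `c_r` -/
  offset : ι → ℝ
  nonempty : {x : Fin n → ℝ | ∀ r, offset r < pair (normal r) x}.Nonempty
  bounded : Bornology.IsBounded {x : Fin n → ℝ | ∀ r, offset r < pair (normal r) x}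
  /-- each inequality defines a face of codimension one, and these faces are distinct -/
  facet : ∀ r, ∃ x : Fin n → ℝ, pair (normal r) x = offset r ∧
    ∀ s, s ≠ r → offset s < pair (normal s) x
  /-- at each vertex, the forms of the facets through it are a basis of the dual lattice
  (in particular they are primitive, and `n` in number) -/
  basis : ∀ p ∈ Set.extremePoints ℝ {x : Fin n → ℝ | ∀ r, offset r ≤ pair (normal r) x},
    LinearIndependent ℤ (fun r : {r // pair (normal r) p = offset r} => normal r) ∧
    Submodule.span ℤ (normal '' {r | pair (normal r) p = offset r}) = ⊤

namespace DelzantPolytope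

variable {n : ℕ} {ι : Type*} (P : DelzantPolytope n ι)

/-- The (open) polytope as a subset of `ℝⁿ`. -/
def carrier : Set (Fin n → ℝ) := {x | ∀ r, P.offset r < pair (P.normal r) x}

/-- The vertices of the polytope. -/
def vertices : Set (Fin n → ℝ) :=
  Set.extremePoints ℝ {x : Fin n → ℝ | ∀ r, P.offset r ≤ pair (P.normal r) x}

/-- The facets which contain the point `p`. -/
def facetsAt (p : Fin n → ℝ) : Set ι := {r | pair (P.normal r) p = P.offset r}

/-- `P` is the polytope of a toric Fano manifold polarised by `K⁻¹`, with preferred centre `ν₀`: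
`λ_r(ν₀) - c_r = 1` for each facet. -/
def IsFanoWithCentre (ν₀ : Fin n → ℝ) : Prop := ∀ r, pair (P.normal r) ν₀ - P.offset r = 1

/-- The affine transformation `g` is a symmetry of `P`: it has the form `x ↦ A x + b` with
`A ∈ GL(n, ℤ)` and it preserves the polytope. -/
def IsSymmetry (g : (Fin n → ℝ) ≃ᵃ[ℝ] (Fin n → ℝ)) : Prop :=
  (∃ (A : GL (Fin n) ℤ) (b : Fin n → ℝ), ∀ x,
    g x = ((A : Matrix (Fin n) (Fin n) ℤ).map fun a => (a : ℝ)) *ᵥ x + b) ∧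
  g '' P.carrier = P.carrier

/-- Homogeneous coordinates: points `z ∈ ℂ^ι` such that the facets `r` with `z_r = 0` have a
vertex in common. -/
def HomogCoord : Type _ :=
  {z : ι → ℂ // ∃ p ∈ P.vertices, ∀ r, z r = 0 → r ∈ P.facetsAt p}

instance : TopologicalSpace P.HomogCoord :=
  inferInstanceAs (TopologicalSpace {z : ι → ℂ // ∃ p ∈ P.vertices, ∀ r, z r = 0 → r ∈ P.facetsAt p})

variable [Fintype ι]

/-- The kernel of the homomorphism `(ℂˣ)^ι → (ℂˣ)ⁿ` given by the forms `λ_r`. -/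
def kernelTorus : Subgroup (ι → ℂˣ) where
  carrier := {t | ∀ j, ∏ r, t r ^ P.normal r j = 1}
  one_mem' := by intro j; simp
  mul_mem' := by
    intro a b ha hb j
    have h1 := ha j
    have h2 := hb j
    simp only [Pi.mul_apply, mul_zpow, Finset.prod_mul_distrib, h1, h2, mul_one]
  inv_mem' := by
    intro a ha j
    have h1 := ha j
    simp only [Pi.inv_apply, inv_zpow, Finset.prod_inv_distrib, h1, inv_one]

/-- Homogeneous coordinates of the same point differ by an element of `kernelTorus`. -/
def homogSetoid : Setoid P.HomogCoord where
  r z w := ∃ t ∈ P.kernelTorus, ∀ r, w.1 r = (t r : ℂ) * z.1 r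
  iseqv :=
    { refl := fun z => ⟨1, P.kernelTorus.one_mem, fun r => by simp⟩
      symm := by
        rintro z w ⟨t, ht, h⟩
        exact ⟨t⁻¹, P.kernelTorus.inv_mem ht, fun r => by simp [h r]⟩
      trans := by
        rintro x y z ⟨t, ht, h⟩ ⟨u, hu, k⟩
        exact ⟨u * t, P.kernelTorus.mul_mem hu ht, fun r => by simp [k r, h r, mul_assoc]⟩ }

/-- The toric manifold `X` of the Delzant polytope `P`. -/
def ToricManifold : Type _ := Quotient P.homogSetoid

/-- The point of `X` with the given homogeneous coordinates. -/
def point (z : P.HomogCoord) : P.ToricManifold := Quotient.mk P.homogSetoid z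

instance : TopologicalSpace P.ToricManifold :=
  inferInstanceAs (TopologicalSpace (Quotient P.homogSetoid))

instance : MeasurableSpace P.ToricManifold := borel _

instance : BorelSpace P.ToricManifold := ⟨rfl⟩

/-- The index set of the charts of `X`: a vertex of `P` together with an ordering of the facets
through this vertex. -/
def ChartIndex : Type _ :=
  {e : Fin n → ι // Function.Injective e ∧ ∃ p ∈ P.vertices, Set.range e = P.facetsAt p}

/-- The holomorphic coordinates `ℂⁿ → X` at a vertex: the homogeneous coordinates of the facets
through the vertex are free and the others are equal to `1`. -/
def chart (e : P.ChartIndex) (z : Fin n → ℂ) : P.ToricManifold :=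
  P.point ⟨Function.extend e.1 z 1, by
    obtain ⟨p, hp, hr⟩ := e.2.2
    refine ⟨p, hp, fun r h0 => ?_⟩
    by_contra hn
    rw [← hr] at hn
    have h1 : Function.extend e.1 z 1 r = (1 : ι → ℂ) r :=
      Function.extend_apply' _ _ _ fun h => hn h
    rw [h1] at h0
    exact one_ne_zero h0⟩

/-- The transformations of `X` in the compact torus `T`: rotations of the homogeneous
coordinates. -/
def torusMaps : Set (Equiv.Perm P.ToricManifold) :=
  {φ | ∃ u : ι → Circle, ∀ z w : P.HomogCoord,
    (∀ r, w.1 r = (u r : ℂ) * z.1 r) → φ (P.point z) = P.point w}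

/-- The transformations of `X` induced by the elements of a group `Γ` of symmetries of `P`: if `γ`
takes the facet `r` to the facet `π r`, it takes the homogeneous coordinate of index `r` to that
of index `π r`. -/
def symmetryMaps (Γ : Subgroup ((Fin n → ℝ) ≃ᵃ[ℝ] (Fin n → ℝ))) :
    Set (Equiv.Perm P.ToricManifold) :=
  {φ | ∃ γ ∈ Γ, ∃ π : Equiv.Perm ι,
    (∀ r x, pair (P.normal (π r)) (γ x) - P.offset (π r) = pair (P.normal r) x - P.offset r) ∧
    ∀ z w : P.HomogCoord, (∀ r, w.1 (π r) = z.1 r) → φ (P.point z) = P.point w}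

/-- The group `T̂` of transformations of `X`, an extension of `Γ` by the compact torus `T`. -/
def extendedTorus (Γ : Subgroup ((Fin n → ℝ) ≃ᵃ[ℝ] (Fin n → ℝ))) :
    Subgroup (Equiv.Perm P.ToricManifold) :=
  Subgroup.closure (P.torusMaps ∪ P.symmetryMaps Γ)

end DelzantPolytope

end ToricAlpha

end

noncomputable section

set_option linter.unusedSectionVars false

/-! The anticanonical bundle has a torus invariant section s which, up to sign, is z_1⋯z_n
∂/∂z_1∧⋯∧∂/∂z_n in every vertex chart (`norm_det_jacobian_transition`); it vanishes exactly on the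
toric divisor, and `sectionNormSq` is |s|². On the open orbit -log|s|² + ψ is a potential of ω₀ +
i∂∂̄ψ. Invariance under T makes it a convex function of y_i = log|z_i| (`convexOn_comp_exp`), and it
is also Γ-invariant. Since ν₀ is the only fixed point, the linear parts of Γ average to zero, and
Jensen's inequality puts the minimum at y = 0 (`orbitPotential_chart_one_le`).

Conversely, the closed unit polydiscs of the charts cover the open orbit, because the cones at the
vertices cover ℝⁿ (`exists_logCoord_nonpos`). In such a polydisc the local potential stays bounded
towards the divisor, so convexity bounds it by its value at y = 0 (`potential_le`). As max ψ = 0,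
that value is bounded below independently of ψ. Together: ψ ≥ log|s|² - C uniformly
(`le_potential`).

Hence e^{-βψ} is at most a constant times |s|^{-2β}. The volume form is at most a constant times
|s|² times Haar measure on the open orbit, and |s|² decays exponentially in y, so the integrals are
uniformly bounded for 0 ≤ β < 1 (`exists_lintegral_le`). For β > 1 the normalised potentials log(δ +
|s|²) are admissible (`testPotential_mem`), and near one divisor their integrals are at least a
constant times δ^{1-β} (`le_one_of_lintegral_le`).

Only ω₀ is assumed invariant, not the Hermitian metric. An automorphism in T or induced by Γ changes
the log of the metric by a bounded pluriharmonic function, which is constant by Liouville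
(`log_normSq_sub_eq`); evaluation at one suitable point shows that the constant is trivial
(`sectionNormSq_invariant`). -/

namespace ToricAlpha

/-! ### Second derivatives along curves, and the Levi form -/

section SecondDerivative

variable {E : Type*} [NormedAddCommGroup E] [NormedSpace ℝ E]

/-- The second derivative of a real function, as a bilinear form. -/
def hess (f : E → ℝ) (z v w : E) : ℝ := fderiv ℝ (fderiv ℝ f) z v w

lemma differentiable_fderiv_of_smooth {f : E → ℝ} (hf : ContDiff ℝ ∞ f) :
    Differentiable ℝ (fderiv ℝ f) :=
  (hf.fderiv_right (m := 1) (by norm_cast)).differentiable one_ne_zero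

lemma differentiable_of_smooth {f : E → ℝ} (hf : ContDiff ℝ ∞ f) : Differentiable ℝ f :=
  hf.differentiable (by simp)

lemma hess_symm {f : E → ℝ} (hf : ContDiff ℝ ∞ f) (z v w : E) : hess f z v w = hess f z w v :=
  (hf.contDiffAt.isSymmSndFDerivAt (by simp; norm_cast)) v w

lemma hasFDerivAt_fderiv_apply {f : E → ℝ} (hf : ContDiff ℝ ∞ f) (z w : E) :
    HasFDerivAt (fun x => fderiv ℝ f x w) ((fderiv ℝ (fderiv ℝ f) z).flip w) z := by
  have h := (differentiable_fderiv_of_smooth hf z).hasFDerivAt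
  simpa using h.clm_apply (hasFDerivAt_const w z)

lemma hess_add {f g : E → ℝ} (hf : ContDiff ℝ ∞ f) (hg : ContDiff ℝ ∞ g) (z v w : E) :
    hess (fun x => f x + g x) z v w = hess f z v w + hess g z v w := by
  have h : fderiv ℝ (fun x => f x + g x) = fun x => fderiv ℝ f x + fderiv ℝ g x := by
    ext1 x
    exact fderiv_fun_add (differentiable_of_smooth hf x) (differentiable_of_smooth hg x)
  unfold hess
  rw [h, fderiv_fun_add (differentiable_fderiv_of_smooth hf z)
    (differentiable_fderiv_of_smooth hg z)]
  rfl

lemma hess_neg {f : E → ℝ} (z v w : E) :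
    hess (fun x => -f x) z v w = -hess f z v w := by
  have h : fderiv ℝ (fun x => -f x) = fun x => -fderiv ℝ f x := by
    ext1 x
    exact fderiv_fun_neg
  unfold hess
  rw [h, fderiv_fun_neg]
  rfl

lemma hasDerivAt_comp_curve {f : E → ℝ} (hf : ContDiff ℝ ∞ f) {γ : ℝ → E} {v : E} {t : ℝ}
    (h : HasDerivAt γ v t) : HasDerivAt (fun s => f (γ s)) (fderiv ℝ f (γ t) v) t :=
  (differentiable_of_smooth hf (γ t)).hasFDerivAt.comp_hasDerivAt t h

lemma hasDerivAt_deriv_comp_curve {f : E → ℝ} (hf : ContDiff ℝ ∞ f) {γ γ' : ℝ → E} {a : E} {t : ℝ}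
    (h : HasDerivAt γ (γ' t) t) (h' : HasDerivAt γ' a t) :
    HasDerivAt (fun s => fderiv ℝ f (γ s) (γ' s))
      (hess f (γ t) (γ' t) (γ' t) + fderiv ℝ f (γ t) a) t := by
  have h1 := (differentiable_fderiv_of_smooth hf (γ t)).hasFDerivAt.comp_hasDerivAt t h
  exact h1.clm_apply h'

variable [NormedSpace ℂ E]

/-- The Levi form of `f` at `z` in the direction `b` (times `4`). -/
def levi (f : E → ℝ) (z b : E) : ℝ :=
  hess f z b b + hess f z (Complex.I • b) (Complex.I • b)

lemma levi_add {f g : E → ℝ} (hf : ContDiff ℝ ∞ f) (hg : ContDiff ℝ ∞ g) (z b : E) :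
    levi (fun x => f x + g x) z b = levi f z b + levi g z b := by
  simp only [levi, hess_add hf hg]; ring

lemma levi_neg {f : E → ℝ} (z b : E) : levi (fun x => -f x) z b = -levi f z b := by
  simp only [levi, hess_neg]; ring

end SecondDerivative

/-! ### Complex Hessian matrices as Levi forms -/

section Hermitian

variable {n : ℕ}

/-- A complex linear functional on `ℂⁿ`, written through a real bilinear form. -/
def hermitianForm (B : (Fin n → ℂ) →L[ℝ] (Fin n → ℂ) →L[ℝ] ℝ) (w : Fin n → ℂ) :
    (Fin n → ℂ) →ₗ[ℂ] ℂ where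
  toFun v := (B v w : ℂ) + B (Complex.I • v) (Complex.I • w)
    + Complex.I * (B v (Complex.I • w) - B (Complex.I • v) w)
  map_add' u v := by
    simp only [smul_add, map_add, add_apply, Complex.ofReal_add]; ring
  map_smul' c v := by
    have hI : Complex.I • Complex.I • v = -v := by
      rw [smul_smul, Complex.I_mul_I, neg_one_smul]
    have hc : c • v = c.re • v + c.im • (Complex.I • v) := by
      conv_lhs => rw [← Complex.re_add_im c]
      rw [add_smul, mul_smul, Complex.coe_smul, Complex.coe_smul]
    have hIc : Complex.I • c • v = c.re • (Complex.I • v) - c.im • v := by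
      rw [hc, smul_add, smul_comm Complex.I c.re, smul_comm Complex.I c.im, hI, smul_neg,
        sub_eq_add_neg]
    rw [hIc, hc]
    simp only [map_add, map_sub, map_smul, add_apply, sub_apply, smul_apply, smul_eq_mul,
      RingHom.id_apply, Complex.ofReal_add, Complex.ofReal_sub, Complex.ofReal_mul]
    apply Complex.ext <;> simp <;> ring

lemma hermitianForm_apply (B : (Fin n → ℂ) →L[ℝ] (Fin n → ℂ) →L[ℝ] ℝ) (v w : Fin n → ℂ) :
    hermitianForm B w v = (B v w : ℂ) + B (Complex.I • v) (Complex.I • w)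
    + Complex.I * (B v (Complex.I • w) - B (Complex.I • v) w) := rfl

lemma hermitianForm_conj (B : (Fin n → ℂ) →L[ℝ] (Fin n → ℂ) →L[ℝ] ℝ)
    (hB : ∀ v w, B v w = B w v) (v w : Fin n → ℂ) :
    (starRingEnd ℂ) (hermitianForm B w v) = hermitianForm B v w := by
  rw [hermitianForm_apply, hermitianForm_apply, hB w v, hB w, hB _ v,
    hB (Complex.I • w) (Complex.I • v)]
  apply Complex.ext <;> simp

lemma hermitianForm_sum (B : (Fin n → ℂ) →L[ℝ] (Fin n → ℂ) →L[ℝ] ℝ) (b w : Fin n → ℂ) :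
    hermitianForm B w b = ∑ i, b i * hermitianForm B w (Pi.single i 1) := by
  conv_lhs => rw [pi_eq_sum_univ' b]
  simp [map_sum, map_smul]

/-- Each Wirtinger derivative carries a factor 1/2, whence the quarter. `hermitianForm` is the
sesquilinear polarisation of the Levi form. -/
lemma complexHessian_apply {f : (Fin n → ℂ) → ℝ} (hf : ContDiff ℝ ∞ f) (z : Fin n → ℂ)
    (i j : Fin n) :
    complexHessian f z i j =
      hermitianForm (fderiv ℝ (fderiv ℝ f) z) (Pi.single j 1) (Pi.single i 1) / 4 := by
  have hI : ∀ i : Fin n, Complex.I • (Pi.single i 1 : Fin n → ℂ) = Pi.single i Complex.I := by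
    intro i; rw [← Pi.single_smul]; simp
  have h1 : ∀ w v : Fin n → ℂ, fderiv ℝ (fun v => (f v : ℂ)) w v = (fderiv ℝ f w v : ℂ) := by
    intro w v
    have := Complex.ofRealCLM.hasFDerivAt.comp w (differentiable_of_smooth hf w).hasFDerivAt
    have h2 : fderiv ℝ (fun v => (f v : ℂ)) w = _ := this.fderiv
    rw [h2]; rfl
  have h2 : (fun w => dzbar (fun v => (f v : ℂ)) j w) = fun w =>
      ((fderiv ℝ f w (Pi.single j 1) : ℂ)
        + Complex.I * (fderiv ℝ f w (Pi.single j Complex.I) : ℂ)) / 2 := by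
    ext1 w; simp only [dzbar, h1]
  have h3 : HasFDerivAt (fun w => dzbar (fun v => (f v : ℂ)) j w)
      ((2⁻¹ : ℂ) • (Complex.ofRealCLM.comp ((fderiv ℝ (fderiv ℝ f) z).flip (Pi.single j 1)) +
        Complex.I • (Complex.ofRealCLM.comp
          ((fderiv ℝ (fderiv ℝ f) z).flip (Pi.single j Complex.I))))) z := by
    rw [h2]
    have ha := Complex.ofRealCLM.hasFDerivAt.comp z
      (hasFDerivAt_fderiv_apply hf z (Pi.single j 1))
    have hb := Complex.ofRealCLM.hasFDerivAt.comp z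
      (hasFDerivAt_fderiv_apply hf z (Pi.single j Complex.I))
    refine ((ha.add (hb.const_smul Complex.I)).const_smul (2⁻¹ : ℂ)).congr_of_eventuallyEq ?_
    refine Filter.Eventually.of_forall fun w => ?_
    simp [div_eq_inv_mul]
  simp only [complexHessian, Matrix.of_apply, dz, h3.fderiv, hermitianForm_apply, hI]
  simp
  ring_nf
  simp
  ring

lemma sum_complexHessian {f : (Fin n → ℂ) → ℝ} (hf : ContDiff ℝ ∞ f) (z b : Fin n → ℂ) :
    ∑ i, ∑ j, b i * complexHessian f z i j * (starRingEnd ℂ) (b j) = ((levi f z b / 4 : ℝ) : ℂ) := by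
  set B := fderiv ℝ (fderiv ℝ f) z with hBdef
  have hB : ∀ v w, B v w = B w v := fun v w => hess_symm hf z v w
  have hI : Complex.I • Complex.I • b = -b := by
    rw [smul_smul, Complex.I_mul_I, neg_one_smul]
  have h1 : hermitianForm B b b = ((levi f z b : ℝ) : ℂ) := by
    rw [hermitianForm_apply, hB b (Complex.I • b), sub_self, mul_zero, add_zero]
    simp [levi, hess, B]
  have h2 : hermitianForm B b b =
      ∑ i, ∑ j, b i * hermitianForm B (Pi.single j 1) (Pi.single i 1) * (starRingEnd ℂ) (b j) := by
    rw [hermitianForm_sum B b b]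
    refine Finset.sum_congr rfl fun i _ => ?_
    rw [← hermitianForm_conj B hB, hermitianForm_sum B b, map_sum, Finset.mul_sum]
    refine Finset.sum_congr rfl fun j _ => ?_
    rw [map_mul, hermitianForm_conj B hB]; ring
  have h3 : ∀ i j, b i * complexHessian f z i j * (starRingEnd ℂ) (b j) =
      b i * hermitianForm B (Pi.single j 1) (Pi.single i 1) * (starRingEnd ℂ) (b j) / 4 := by
    intro i j; rw [complexHessian_apply hf]; ring
  simp only [h3, ← Finset.sum_div]
  rw [← h2, h1]; simp

/-- `Matrix.PosDef` conjugates the left vector, while the entries f_{ij̄} pair with b_i b̄_j; so the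
Levi form appears at `star b`. Positivity is unaffected, conjugation being bijective. -/
lemma dotProduct_complexHessian {f : (Fin n → ℂ) → ℝ} (hf : ContDiff ℝ ∞ f) (z b : Fin n → ℂ) :
    star b ⬝ᵥ (complexHessian f z *ᵥ b) = ((levi f z (star b) / 4 : ℝ) : ℂ) := by
  rw [← sum_complexHessian hf]
  simp only [dotProduct, Matrix.mulVec, Finset.mul_sum, Pi.star_apply]
  simp [mul_assoc]

lemma complexHessian_isHermitian {f : (Fin n → ℂ) → ℝ} (hf : ContDiff ℝ ∞ f) (z : Fin n → ℂ) :
    (complexHessian f z).IsHermitian := by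
  ext i j
  rw [Matrix.conjTranspose_apply, complexHessian_apply hf, complexHessian_apply hf, star_div₀,
    ← starRingEnd_apply, hermitianForm_conj _ (fun v w => hess_symm hf z v w)]
  simp

lemma posDef_complexHessian_iff {f : (Fin n → ℂ) → ℝ} (hf : ContDiff ℝ ∞ f) (z : Fin n → ℂ) :
    (complexHessian f z).PosDef ↔ ∀ b, b ≠ 0 → 0 < levi f z b := by
  constructor
  · intro h b hb
    have hb' : star b ≠ 0 := by simpa using hb
    have := h.dotProduct_mulVec_pos hb'
    rw [dotProduct_complexHessian hf, star_star] at this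
    have h2 : (0 : ℝ) < levi f z b / 4 := by exact_mod_cast this
    linarith
  · intro h
    refine Matrix.PosDef.of_dotProduct_mulVec_pos (complexHessian_isHermitian hf z) fun b hb => ?_
    rw [dotProduct_complexHessian hf]
    have hb' : star b ≠ 0 := by simpa using hb
    have := h _ hb'
    have h2 : (0 : ℝ) < levi f z (star b) / 4 := by linarith
    exact_mod_cast h2

lemma complexHessian_add {f g : (Fin n → ℂ) → ℝ} (hf : ContDiff ℝ ∞ f) (hg : ContDiff ℝ ∞ g)
    (z : Fin n → ℂ) :
    complexHessian (fun x => f x + g x) z = complexHessian f z + complexHessian g z := by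
  ext i j
  have h : ∀ v w, fderiv ℝ (fderiv ℝ fun x => f x + g x) z v w = _ := hess_add hf hg z
  rw [Matrix.add_apply, complexHessian_apply hf, complexHessian_apply hg,
    complexHessian_apply (hf.add hg)]
  simp only [hermitianForm_apply, h, hess]
  push_cast; ring

lemma complexHessian_neg {f : (Fin n → ℂ) → ℝ} (hf : ContDiff ℝ ∞ f) (z : Fin n → ℂ) :
    complexHessian (fun x => -f x) z = -complexHessian f z := by
  ext i j
  have h : ∀ v w, fderiv ℝ (fderiv ℝ fun x => -f x) z v w = _ := hess_neg (f := f) z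
  rw [Matrix.neg_apply, complexHessian_apply hf, complexHessian_apply hf.neg]
  simp only [hermitianForm_apply, h, hess]
  push_cast; ring

/-- Two functions with proportional complex Hessians along a linear change of variables have the
same Levi form. -/
lemma levi_eq_of_complexHessian {f g : (Fin n → ℂ) → ℝ} (hf : ContDiff ℝ ∞ f)
    (hg : ContDiff ℝ ∞ g) {z w : Fin n → ℂ} (J : Matrix (Fin n) (Fin n) ℂ)
    (h : complexHessian f z = Jᵀ * complexHessian g w * J.map (starRingEnd ℂ)) (b : Fin n → ℂ) :
    levi f z b = levi g w (J *ᵥ b) := by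
  have h1 := dotProduct_complexHessian hf z (star b)
  have h2 := dotProduct_complexHessian hg w (star (J *ᵥ b))
  rw [star_star] at h1 h2
  have h3 : J.map (starRingEnd ℂ) *ᵥ star b = star (J *ᵥ b) := by
    ext i; simp [Matrix.mulVec, dotProduct]
  rw [h, ← Matrix.mulVec_mulVec, ← Matrix.mulVec_mulVec, h3, Matrix.dotProduct_mulVec,
    Matrix.vecMul_transpose, h2] at h1
  have : levi g w (J *ᵥ b) / 4 = levi f z b / 4 := by exact_mod_cast h1
  linarith

end Hermitian

/-! ### Second derivatives under linear substitutions and along lines -/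

section LinearChange

variable {E F : Type*} [NormedAddCommGroup E] [NormedSpace ℝ E] [NormedAddCommGroup F]
  [NormedSpace ℝ F]

lemma hess_comp_continuousLinearMap {f : F → ℝ} (hf : ContDiff ℝ ∞ f) (L : E →L[ℝ] F)
    (z v w : E) : hess (fun x => f (L x)) z v w = hess f (L z) (L v) (L w) := by
  have h1 : ∀ x, HasFDerivAt (fun x => f (L x)) ((fderiv ℝ f (L x)).comp L) x := fun x =>
    (differentiable_of_smooth hf (L x)).hasFDerivAt.comp x L.hasFDerivAt
  have h2 : fderiv ℝ (fun x => f (L x)) = fun x => (fderiv ℝ f (L x)).comp L :=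
    funext fun x => (h1 x).fderiv
  have h3 : HasFDerivAt (fun x => fderiv ℝ f (L x)) ((fderiv ℝ (fderiv ℝ f) (L z)).comp L) z :=
    (differentiable_fderiv_of_smooth hf (L z)).hasFDerivAt.comp z L.hasFDerivAt
  have h4 := h3.clm_comp (hasFDerivAt_const L z)
  unfold hess
  rw [h2, h4.fderiv]
  simp

/-- The second derivative read off along a line. -/
lemma hess_eq_of_hasDerivAt {f : E → ℝ} (hf : ContDiff ℝ ∞ f) (z a : E) {g : ℝ → ℝ} {d : ℝ}
    (h1 : ∀ t : ℝ, HasDerivAt (fun s : ℝ => f (z + s • a)) (g t) t) (h2 : HasDerivAt g d 0) :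
    hess f z a a = d := by
  have hl : ∀ t : ℝ, HasDerivAt (fun s : ℝ => z + s • a) a t := fun t => by
    simpa using ((hasDerivAt_id t).smul_const a).const_add z
  have hg : g = fun t => fderiv ℝ f (z + t • a) a :=
    funext fun t => (h1 t).unique (hasDerivAt_comp_curve hf (hl t))
  have h3 := hasDerivAt_deriv_comp_curve hf (γ := fun s : ℝ => z + s • a) (γ' := fun _ => a)
    (hl 0) (hasDerivAt_const 0 a)
  rw [hg] at h2
  simpa using h3.unique h2

end LinearChange

/-! ### Liouville's theorem for pluriharmonic functions -/

section Liouville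

variable {n : ℕ}

/-- A bounded pluriharmonic function on `ℂⁿ` is constant. -/
lemma eq_of_levi_eq_zero_of_bounded {f : (Fin n → ℂ) → ℝ} (hf : ContDiff ℝ ∞ f)
    (h0 : ∀ z b, levi f z b = 0) {C : ℝ} (hC : ∀ z, |f z| ≤ C) (z : Fin n → ℂ) : f z = f 0 := by
  -- On the complex line through 0 and z the Levi form is the Laplacian, so the planar Liouville
  -- theorem applies.
  set L : ℂ →L[ℝ] (Fin n → ℂ) := (ContinuousLinearMap.toSpanSingleton ℂ z).restrictScalars ℝ
  have hL : ∀ ζ : ℂ, L ζ = ζ • z := fun ζ => rfl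
  have hg : ContDiff ℝ ∞ fun ζ : ℂ => f (L ζ) := hf.comp L.contDiff
  have hharm : InnerProductSpace.HarmonicOnNhd (fun ζ : ℂ => f (L ζ)) Set.univ := by
    intro ζ _
    refine ⟨(hg.of_le (by norm_cast)).contDiffAt, Filter.Eventually.of_forall fun ξ => ?_⟩
    rw [InnerProductSpace.laplacian_eq_iteratedFDeriv_complexPlane]
    simp only [iteratedFDeriv_two_apply]
    have := h0 (L ξ) z
    have h1 := hess_comp_continuousLinearMap hf L ξ 1 1
    have h2 := hess_comp_continuousLinearMap hf L ξ Complex.I Complex.I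
    simp only [hL, one_smul, hess, levi] at this h1 h2
    simp only [hL, Matrix.cons_val_zero, Matrix.cons_val_one, h1, h2, this, Pi.zero_apply]
  have := InnerProductSpace.bounded_harmonic_on_complex_plane_is_constant _ hharm
    (isBounded_iff_forall_norm_le.2 ⟨C, by rintro _ ⟨ζ, rfl⟩; exact hC _⟩) 1 0
  simpa [hL] using this

end Liouville

/-! ### Plurisubharmonic functions with torus symmetry -/

section Convexity

variable {n : ℕ}

/-- A rotation invariant plurisubharmonic function is convex in logarithmic coordinates. -/
lemma convexOn_comp_exp {f : (Fin n → ℂ) → ℝ} (hf : ContDiff ℝ ∞ f)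
    (hlevi : ∀ z b, 0 ≤ levi f z b)
    (hinv : ∀ R z : Fin n → ℂ, (∀ i, ‖R i‖ = 1) → f (R * z) = f z) :
    ConvexOn ℝ Set.univ fun y : Fin n → ℝ => f fun i => (Real.exp (y i) : ℂ) := by
  have key : ∀ y v : Fin n → ℝ, ConvexOn ℝ Set.univ
      fun t : ℝ => f fun i => (Real.exp (y i + t * v i) : ℂ) := by
    intro y v
    set γ : ℝ → Fin n → ℂ := fun t i => (Real.exp (y i + t * v i) : ℂ)
    set γ' : ℝ → Fin n → ℂ := fun t i => (v i : ℂ) * γ t i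
    set γ'' : ℝ → Fin n → ℂ := fun t i => (v i : ℂ) * γ' t i
    have hγ : ∀ t, HasDerivAt γ (γ' t) t := by
      intro t
      rw [hasDerivAt_pi]
      intro i
      have h1 : HasDerivAt (fun t : ℝ => y i + t * v i) (v i) t := by
        simpa using ((hasDerivAt_id t).mul_const (v i)).const_add (y i)
      simpa [γ', γ, mul_comm] using h1.exp.ofReal_comp
    have hγ' : ∀ t, HasDerivAt γ' (γ'' t) t := by
      intro t
      rw [hasDerivAt_pi]
      intro i
      exact (hasDerivAt_pi.1 (hγ t) i).const_mul (v i : ℂ)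
    have h1 : ∀ t, HasDerivAt (fun s => f (γ s)) (fderiv ℝ f (γ t) (γ' t)) t := fun t =>
      hasDerivAt_comp_curve hf (hγ t)
    have h2 : ∀ t, HasDerivAt (fun s => fderiv ℝ f (γ s) (γ' s))
        (hess f (γ t) (γ' t) (γ' t) + fderiv ℝ f (γ t) (γ'' t)) t := fun t =>
      hasDerivAt_deriv_comp_curve hf (hγ t) (hγ' t)
    -- The curve δ rotates the point γ t, so f is constant along it. Its vanishing second derivative
    -- gives hess f(Iγ', Iγ') = df(γ''), because δ' = Iγ' and δ'' = -γ'' at 0. The second derivative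
    -- along γ is therefore the Levi form in the direction γ'.
    have h3 : ∀ t, 0 ≤ hess f (γ t) (γ' t) (γ' t) + fderiv ℝ f (γ t) (γ'' t) := by
      intro t
      set δ : ℝ → Fin n → ℂ := fun s i => Complex.exp (Complex.I * (s * v i)) * γ t i
      set δ' : ℝ → Fin n → ℂ := fun s i => (Complex.I * v i) * δ s i
      set δ'' : ℝ → Fin n → ℂ := fun s i => (Complex.I * v i) * δ' s i
      have hδ : ∀ s, HasDerivAt δ (δ' s) s := by
        intro s
        rw [hasDerivAt_pi]
        intro i
        have h1 : HasDerivAt (fun s : ℝ => Complex.I * ((s : ℂ) * v i)) (Complex.I * v i) s := by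
          simpa using ((hasDerivAt_id s).ofReal_comp.mul_const (v i : ℂ)).const_mul Complex.I
        refine (h1.cexp.mul_const (γ t i)).congr_deriv ?_
        simp only [δ', δ]; ring
      have hδ' : ∀ s, HasDerivAt δ' (δ'' s) s := by
        intro s
        rw [hasDerivAt_pi]
        intro i
        exact (hasDerivAt_pi.1 (hδ s) i).const_mul (Complex.I * (v i : ℂ))
      have hc : (fun s => f (δ s)) = fun _ => f (γ t) := by
        ext s
        refine hinv (fun i => Complex.exp (Complex.I * (s * v i))) (γ t) fun i => ?_
        have : Complex.I * ((s : ℂ) * v i) = ((s * v i : ℝ) : ℂ) * Complex.I := by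
          push_cast; ring
        rw [this, Complex.norm_exp_ofReal_mul_I]
      have e1 : (fun s => fderiv ℝ f (δ s) (δ' s)) = fun _ => 0 := by
        ext s
        have h := hasDerivAt_comp_curve hf (hδ s)
        rw [hc] at h
        exact h.unique (hasDerivAt_const s _)
      have e2 := hasDerivAt_deriv_comp_curve hf (hδ 0) (hδ' 0)
      rw [e1] at e2
      have e3 := e2.unique (hasDerivAt_const (0 : ℝ) (0 : ℝ))
      have f0 : δ 0 = γ t := by ext i; simp [δ]
      have f1 : δ' 0 = Complex.I • γ' t := by
        ext i; simp only [δ', f0, γ', Pi.smul_apply, smul_eq_mul]; ring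
      have f2 : δ'' 0 = -γ'' t := by
        ext i
        simp only [δ'', f1, γ'', γ', Pi.smul_apply, smul_eq_mul, Pi.neg_apply]
        linear_combination (v i * (v i * γ t i)) * Complex.I_mul_I
      rw [f0, f1, f2, map_neg] at e3
      have := hlevi (γ t) (γ' t)
      unfold levi at this
      linarith
    have d1 : deriv (fun s => f (γ s)) = fun t => fderiv ℝ f (γ t) (γ' t) :=
      funext fun t => (h1 t).deriv
    refine convexOn_univ_of_deriv2_nonneg (fun t => (h1 t).differentiableAt) ?_ ?_
    · rw [d1]; exact fun t => (h2 t).differentiableAt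
    · intro t
      simp only [Function.iterate_succ, Function.iterate_zero, Function.comp_apply, id_eq]
      rw [d1, (h2 t).deriv]
      exact h3 t
  refine ⟨convex_univ, fun x _ y _ a b ha hb hab => ?_⟩
  have := (key x (y - x)).2 (Set.mem_univ 0) (Set.mem_univ 1) ha hb hab
  simp only [smul_eq_mul, mul_zero, mul_one, zero_add, zero_mul, add_zero, one_mul,
    Pi.sub_apply, add_sub_cancel] at this
  have ha' : a = 1 - b := by linarith
  have e : ∀ i, (a • x + b • y) i = x i + b * (y i - x i) := fun i => by
    simp only [Pi.add_apply, Pi.smul_apply, smul_eq_mul, ha']; ring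
  simpa only [e, smul_eq_mul] using this

end Convexity

/-! ### Strict plurisubharmonicity of the logarithm of a sum -/

section LogSum

variable {n : ℕ}

/-- Here E = δeᵘ, q = x + iy, q' = p + ir, q'' = s + iw, and u_j, h_j are the first and second
derivatives of u along b and Ib. The terms in q'' cancel between the two directions, and what is
left is E·F·(h1 + h2) plus E·|q(u1 - iu2) - 2q'|², over F², with F = E + |q|². -/
lemma levi_log_pos_aux {E x y p r s w u1 u2 h1 h2 : ℝ} (hE : 0 < E) (hL : 0 < h1 + h2) :
    0 < ((E * (h1 + u1 * u1) + (2 * (p * p + r * r) + 2 * (x * s + y * w))) / (E + (x * x + y * y))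
      - (E * u1 + 2 * (x * p + y * r)) ^ 2 / (E + (x * x + y * y)) ^ 2)
      + ((E * (h2 + u2 * u2) + (2 * (p * p + r * r) - 2 * (x * s + y * w)))
        / (E + (x * x + y * y))
      - (E * u2 + 2 * (y * p - x * r)) ^ 2 / (E + (x * x + y * y)) ^ 2) := by
  have hF : 0 < E + (x * x + y * y) := by nlinarith [mul_self_nonneg x, mul_self_nonneg y]
  have key : ((E * (h1 + u1 * u1) + (2 * (p * p + r * r) + 2 * (x * s + y * w)))
        / (E + (x * x + y * y))
      - (E * u1 + 2 * (x * p + y * r)) ^ 2 / (E + (x * x + y * y)) ^ 2)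
      + ((E * (h2 + u2 * u2) + (2 * (p * p + r * r) - 2 * (x * s + y * w)))
        / (E + (x * x + y * y))
      - (E * u2 + 2 * (y * p - x * r)) ^ 2 / (E + (x * x + y * y)) ^ 2) =
      ((E + (x * x + y * y)) * E * (h1 + h2) +
        E * ((x * u1 + y * u2 - 2 * p) ^ 2 + (y * u1 - x * u2 - 2 * r) ^ 2)) /
      (E + (x * x + y * y)) ^ 2 := by
    field_simp
    ring
  rw [key]
  positivity

lemma hasDerivAt_normSq_line {q q' : ℂ → ℂ} (hq : ∀ ζ, HasDerivAt q (q' ζ) ζ) (c : ℂ) (t : ℝ) :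
    HasDerivAt (fun s : ℝ => Complex.normSq (q (s * c)))
      (2 * ((q (t * c)).re * (c * q' (t * c)).re + (q (t * c)).im * (c * q' (t * c)).im)) t := by
  have h1 : HasDerivAt (fun s : ℝ => q (s * c)) (c * q' (t * c)) t := by
    have h2 : HasDerivAt (fun s : ℝ => (s : ℂ) * c) c t := by
      simpa using (hasDerivAt_id t).ofReal_comp.mul_const c
    have := (hq (t * c)).comp t h2
    rwa [mul_comm] at this
  have hre := Complex.reCLM.hasFDerivAt.comp_hasDerivAt t h1
  have him := Complex.imCLM.hasFDerivAt.comp_hasDerivAt t h1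
  have := (hre.mul hre).add (him.mul him)
  refine HasDerivAt.congr_deriv this ?_
  simp only [Complex.reCLM_apply, Complex.imCLM_apply, Function.comp_def]
  ring

lemma hasDerivAt_normSq_line' {q q' q'' : ℂ → ℂ} (hq : ∀ ζ, HasDerivAt q (q' ζ) ζ)
    (hq' : ∀ ζ, HasDerivAt q' (q'' ζ) ζ) (c : ℂ) :
    HasDerivAt (fun t : ℝ =>
      2 * ((q (t * c)).re * (c * q' (t * c)).re + (q (t * c)).im * (c * q' (t * c)).im))
      (2 * ((c * q' 0).re * (c * q' 0).re + (c * q' 0).im * (c * q' 0).im) +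
        2 * ((q 0).re * (c * (c * q'' 0)).re + (q 0).im * (c * (c * q'' 0)).im)) 0 := by
  have h2 : HasDerivAt (fun s : ℝ => (s : ℂ) * c) c (0 : ℝ) := by
    simpa using (hasDerivAt_id (0 : ℝ)).ofReal_comp.mul_const c
  have h1 : HasDerivAt (fun s : ℝ => q (s * c)) (c * q' 0) (0 : ℝ) := by
    have := (hq (((0 : ℝ) : ℂ) * c)).comp (0 : ℝ) h2
    rw [mul_comm] at this
    simpa [Function.comp_def] using this
  have h1' : HasDerivAt (fun s : ℝ => c * q' (s * c)) (c * (c * q'' 0)) (0 : ℝ) := by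
    have := ((hq' (((0 : ℝ) : ℂ) * c)).comp (0 : ℝ) h2).const_mul c
    rw [mul_comm (q'' _)] at this
    simpa [Function.comp_def] using this
  have hre := Complex.reCLM.hasFDerivAt.comp_hasDerivAt (0 : ℝ) h1
  have him := Complex.imCLM.hasFDerivAt.comp_hasDerivAt (0 : ℝ) h1
  have hre' := Complex.reCLM.hasFDerivAt.comp_hasDerivAt (0 : ℝ) h1'
  have him' := Complex.imCLM.hasFDerivAt.comp_hasDerivAt (0 : ℝ) h1'
  have := ((hre.mul hre').add (him.mul him')).const_mul (2 : ℝ)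
  refine HasDerivAt.congr_deriv this ?_
  simp only [Complex.reCLM_apply, Complex.imCLM_apply, Function.comp_def, Complex.ofReal_zero,
    zero_mul]
  ring

/-- If `u` is strictly plurisubharmonic then so is `log (δ eᵘ + |q|²)`, for `q` holomorphic. -/
lemma levi_log_pos {E : Type*} [NormedAddCommGroup E] [NormedSpace ℂ E]
    {u : E → ℝ} (hu : ContDiff ℝ ∞ u) {Q : E → ℂ}
    (hQ : ContDiff ℂ ∞ Q) {δ : ℝ} (hδ : 0 < δ)
    (hG : ContDiff ℝ ∞ fun z => Real.log (δ * Real.exp (u z) + Complex.normSq (Q z)))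
    (z b : E) (hL : 0 < levi u z b) :
    0 < levi (fun z => Real.log (δ * Real.exp (u z) + Complex.normSq (Q z))) z b := by
  set q : ℂ → ℂ := fun ζ => Q (z + ζ • b)
  have hqs : ContDiff ℂ ∞ q := hQ.comp (contDiff_const.add (contDiff_id.smul contDiff_const))
  have hq : ∀ ζ, HasDerivAt q (deriv q ζ) ζ := fun ζ =>
    (hqs.differentiable (by simp) ζ).hasDerivAt
  have hq' : ∀ ζ, HasDerivAt (deriv q) (deriv (deriv q) ζ) ζ := fun ζ =>
    ((hqs.of_le (m := 2) (by norm_cast)).differentiable_deriv_two ζ).hasDerivAt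
  -- The second derivative along the real direction c • b, by the quotient rule; c = 1 and c = I are
  -- the two halves of the Levi form.
  have key : ∀ c : ℂ, hess (fun z => Real.log (δ * Real.exp (u z) + Complex.normSq (Q z))) z
      (c • b) (c • b) =
      (δ * Real.exp (u z) * (hess u z (c • b) (c • b)
        + fderiv ℝ u z (c • b) * fderiv ℝ u z (c • b)) +
        (2 * ((c * deriv q 0).re * (c * deriv q 0).re + (c * deriv q 0).im * (c * deriv q 0).im) +
        2 * ((q 0).re * (c * (c * deriv (deriv q) 0)).re
          + (q 0).im * (c * (c * deriv (deriv q) 0)).im))) /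
        (δ * Real.exp (u z) + ((q 0).re * (q 0).re + (q 0).im * (q 0).im)) -
      (δ * Real.exp (u z) * fderiv ℝ u z (c • b) +
        2 * ((q 0).re * (c * deriv q 0).re + (q 0).im * (c * deriv q 0).im)) ^ 2 /
      (δ * Real.exp (u z) + ((q 0).re * (q 0).re + (q 0).im * (q 0).im)) ^ 2 := by
    intro c
    set a := c • b with ha
    have hl : ∀ t : ℝ, HasDerivAt (fun s : ℝ => z + s • a) a t := fun t => by
      simpa using ((hasDerivAt_id t).smul_const a).const_add z
    have hQl : ∀ t : ℝ, Q (z + t • a) = q (t * c) := by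
      intro t; simp only [q, ha, mul_smul, Complex.coe_smul]
    have hE : ∀ t : ℝ, HasDerivAt (fun s : ℝ => δ * Real.exp (u (z + s • a)))
        (δ * Real.exp (u (z + t • a)) * fderiv ℝ u (z + t • a) a) t := fun t => by
      have := (hasDerivAt_comp_curve hu (hl t)).exp.const_mul δ
      rwa [← mul_assoc] at this
    have hE' : HasDerivAt (fun t : ℝ => δ * Real.exp (u (z + t • a)) * fderiv ℝ u (z + t • a) a)
        (δ * Real.exp (u z) * (hess u z a a + fderiv ℝ u z a * fderiv ℝ u z a)) 0 := by
      have h3 := hasDerivAt_deriv_comp_curve hu (γ := fun s : ℝ => z + s • a) (γ' := fun _ => a)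
        (hl 0) (hasDerivAt_const 0 a)
      refine HasDerivAt.congr_deriv ((hE 0).mul h3) ?_
      simp only [zero_smul, add_zero, map_zero]
      ring
    have hpos : ∀ t : ℝ, δ * Real.exp (u (z + t • a)) + Complex.normSq (q (t * c)) ≠ 0 := by
      intro t
      have := Complex.normSq_nonneg (q (t * c))
      positivity
    refine hess_eq_of_hasDerivAt hG z a (fun t => ?_) (?_ : HasDerivAt (fun t : ℝ =>
      (δ * Real.exp (u (z + t • a)) * fderiv ℝ u (z + t • a) a +
        2 * ((q (t * c)).re * (c * deriv q (t * c)).re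
          + (q (t * c)).im * (c * deriv q (t * c)).im)) /
      (δ * Real.exp (u (z + t • a)) + Complex.normSq (q (t * c)))) _ 0)
    · simp only [hQl]
      exact ((hE t).add (hasDerivAt_normSq_line hq c t)).log (hpos t)
    · have := (hE'.add (hasDerivAt_normSq_line' hq hq' c)).div
        ((hE 0).add (hasDerivAt_normSq_line hq c 0)) (hpos 0)
      refine HasDerivAt.congr_deriv this ?_
      have := hpos 0
      simp only [zero_smul, add_zero, Complex.ofReal_zero, zero_mul, Complex.normSq_apply,
        Pi.add_apply] at this ⊢
      field_simp
  have k1 := key 1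
  have k2 := key Complex.I
  rw [one_smul] at k1
  unfold levi at hL ⊢
  rw [k1, k2]
  convert levi_log_pos_aux (E := δ * Real.exp (u z)) (x := (q 0).re) (y := (q 0).im)
    (p := (deriv q 0).re) (r := (deriv q 0).im) (s := (deriv (deriv q) 0).re)
    (w := (deriv (deriv q) 0).im) (u1 := fderiv ℝ u z b) (u2 := fderiv ℝ u z (Complex.I • b))
    (by positivity) hL using 3
  · simp
  · simp
  · simp; ring
  · simp; ring

end LogSum

/-! ### Vertex charts of the toric manifold -/

namespace DelzantPolytope

variable {n : ℕ} {ι : Type*} (P : DelzantPolytope n ι)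

/-- The closed polytope. -/
def closedCarrier : Set (Fin n → ℝ) := {x | ∀ r, P.offset r ≤ pair (P.normal r) x}

variable [Fintype ι]

instance : Finite P.ChartIndex := by
  unfold ChartIndex; infer_instance

variable {P}

/-- The facets through the vertex of a chart. -/
def idx (e : P.ChartIndex) : Fin n → ι := e.1

lemma idx_injective (e : P.ChartIndex) : Function.Injective (idx e) := e.2.1

lemma exists_range_idx (e : P.ChartIndex) : ∃ p ∈ P.vertices, Set.range (idx e) = P.facetsAt p :=
  e.2.2

/-- The forms of the facets through the vertex of a chart, as the rows of a matrix. -/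
def chartMatrix (e : P.ChartIndex) : Matrix (Fin n) (Fin n) ℤ :=
  Matrix.of fun i j => P.normal (idx e i) j

/-- The coordinates of the forms `λ_r` in the basis given by a chart. -/
def coords (e : P.ChartIndex) : Matrix ι (Fin n) ℤ := Matrix.of P.normal * (chartMatrix e)⁻¹

/-- The Delzant condition: the normals at the vertex span ℤⁿ, and expressing the standard basis
through them gives an integral left inverse. -/
lemma isUnit_det_chartMatrix (e : P.ChartIndex) : IsUnit (chartMatrix e).det := by
  obtain ⟨p, hp, hr⟩ := (exists_range_idx e)
  have h1 := (P.basis p hp).2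
  have h2 : P.normal '' {r | pair (P.normal r) p = P.offset r} =
      Set.range fun i => P.normal (idx e i) := by
    have : {r | pair (P.normal r) p = P.offset r} = Set.range (idx e) := hr.symm
    rw [this, ← Set.range_comp]; rfl
  rw [h2] at h1
  have h3 : ∀ k : Fin n, ∃ c : Fin n → ℤ, ∑ i, c i • P.normal (idx e i) = Pi.single k 1 := fun k =>
    (Submodule.mem_span_range_iff_exists_fun ℤ).1 (h1 ▸ Submodule.mem_top)
  choose c hc using h3
  have h4 : Matrix.of c * chartMatrix e = 1 := by
    ext k j
    have := congrFun (hc k) j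
    simp only [Finset.sum_apply, Pi.smul_apply, smul_eq_mul] at this
    rw [Matrix.mul_apply, Matrix.one_apply]
    simp only [chartMatrix, Matrix.of_apply, this, Pi.single_apply, eq_comm]
  exact Matrix.isUnit_det_of_left_inverse h4

lemma coords_mul_chartMatrix (e : P.ChartIndex) :
    coords e * chartMatrix e = Matrix.of P.normal := by
  rw [coords, Matrix.mul_assoc, Matrix.nonsing_inv_mul _ (isUnit_det_chartMatrix e), Matrix.mul_one]

lemma sum_coords_mul (e : P.ChartIndex) (r : ι) (j : Fin n) :
    ∑ i, coords e r i * P.normal (idx e i) j = P.normal r j := by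
  have := congrFun (congrFun (coords_mul_chartMatrix e) r) j
  rwa [Matrix.mul_apply] at this

lemma coords_apply_chart (e : P.ChartIndex) (k i : Fin n) :
    coords e (idx e k) i = if k = i then 1 else 0 := by
  have := congrFun (congrFun (Matrix.mul_nonsing_inv _ (isUnit_det_chartMatrix e)) k) i
  rw [Matrix.one_apply] at this
  rw [← this, coords, Matrix.mul_apply, Matrix.mul_apply]
  rfl

/-- The coordinates of a point in a chart, in terms of its homogeneous coordinates. -/
def toChart (e : P.ChartIndex) (z : ι → ℂ) (i : Fin n) : ℂ := ∏ r, z r ^ coords e r i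

/-- The homogeneous coordinates of a point of a chart. -/
def homog (e : P.ChartIndex) (z : Fin n → ℂ) : ι → ℂ := Function.extend (idx e) z 1

@[simp] lemma homog_apply (e : P.ChartIndex) (z : Fin n → ℂ) (i : Fin n) :
    homog e z (idx e i) = z i := (idx_injective e).extend_apply _ _ _

lemma homog_of_notMem (e : P.ChartIndex) (z : Fin n → ℂ) {r : ι} (hr : r ∉ Set.range (idx e)) :
    homog e z r = 1 := Function.extend_apply' _ _ _ fun h => hr h

lemma exists_homogCoord (e : P.ChartIndex) {z : ι → ℂ} (h : ∀ r, r ∉ Set.range (idx e) → z r ≠ 0) :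
    ∃ p ∈ P.vertices, ∀ r, z r = 0 → r ∈ P.facetsAt p := by
  obtain ⟨p, hp, hr⟩ := (exists_range_idx e)
  refine ⟨p, hp, fun r h0 => ?_⟩
  rw [← hr]
  by_contra hn
  exact h r hn h0

/-- Homogeneous coordinates from a vector. -/
def mkHomog (z : ι → ℂ) (h : ∃ p ∈ P.vertices, ∀ r, z r = 0 → r ∈ P.facetsAt p) : P.HomogCoord :=
  ⟨z, h⟩

/-- The vector of homogeneous coordinates. -/
def homogVal (z : P.HomogCoord) : ι → ℂ := z.1

@[simp] lemma homogVal_mkHomog (z : ι → ℂ) (h) : homogVal (P := P) (mkHomog z h) = z := rfl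

lemma homogVal_spec (z : P.HomogCoord) :
    ∃ p ∈ P.vertices, ∀ r, homogVal z r = 0 → r ∈ P.facetsAt p := z.2

lemma continuous_homogVal : Continuous (homogVal (P := P)) := continuous_subtype_val

lemma homog_ne_zero_of_notMem (e : P.ChartIndex) (z : Fin n → ℂ) (r : ι)
    (hr : r ∉ Set.range (idx e)) : homog e z r ≠ 0 := by
  rw [homog_of_notMem e z hr]; exact one_ne_zero

lemma chart_eq_point (e : P.ChartIndex) (z : Fin n → ℂ) :
    P.chart e z = P.point (mkHomog (homog e z) (exists_homogCoord e (homog_ne_zero_of_notMem e z))) := rfl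

lemma point_eq_point_iff {z w : P.HomogCoord} :
    P.point z = P.point w ↔ ∃ t ∈ P.kernelTorus, ∀ r, homogVal w r = (t r : ℂ) * homogVal z r :=
  Quotient.eq (r := P.homogSetoid)

lemma mem_kernelTorus {t : ι → ℂˣ} : t ∈ P.kernelTorus ↔ ∀ j, ∏ r, t r ^ P.normal r j = 1 := Iff.rfl

lemma prod_extend {M : Type*} [CommGroup M] (e : P.ChartIndex) (w : Fin n → M) (m : ι → ℤ) :
    ∏ r, (Function.extend (idx e) w 1 r) ^ m r = ∏ i, w i ^ m (idx e i) := by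
  symm
  refine Fintype.prod_of_injective (idx e) (idx_injective e) _ _ (fun r hr => ?_) fun i => ?_
  · rw [Function.extend_apply' _ _ _ fun h => hr h]; simp
  · rw [(idx_injective e).extend_apply]

lemma prod_homog (e : P.ChartIndex) (w : Fin n → ℂ) (m : ι → ℤ) :
    ∏ r, (homog e w r) ^ m r = ∏ i, w i ^ m (idx e i) := by
  symm
  refine Fintype.prod_of_injective (idx e) (idx_injective e) _ _ (fun r hr => ?_) fun i => ?_
  · rw [homog_of_notMem e w hr]; simp
  · rw [homog_apply]

lemma prod_zpow_eq_zpow_sum {M κ : Type*} [CommGroup M] (s : Finset κ) (a : M) (f : κ → ℤ) :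
    ∏ i ∈ s, a ^ f i = a ^ ∑ i ∈ s, f i :=
  (map_sum (AddMonoidHom.mk' (fun k : ℤ => Additive.ofMul (a ^ k)) fun x y => by
    simp [zpow_add]) f s).symm

/-- The exponents at the chart's own facets are Kronecker deltas, so the monomial splits into one
free coordinate times a unit built from the nonvanishing ones. -/
lemma toChart_apply_of_mem {e : P.ChartIndex} {z : ι → ℂ} (i : Fin n) (s : ι → ℂˣ)
    (hs : ∀ r, r ∉ Set.range (idx e) → (s r : ℂ) = z r) (hs' : ∀ r ∈ Set.range (idx e), s r = 1) :
    toChart e z i = z (idx e i) * (∏ r, s r ^ coords e r i : ℂˣ) := by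
  classical
  push_cast
  have h1 : z (idx e i) = ∏ r, if r = (idx e) i then z r else 1 := by simp
  rw [toChart, h1, ← Finset.prod_mul_distrib]
  refine Finset.prod_congr rfl fun r _ => ?_
  by_cases hr : r ∈ Set.range (idx e)
  · obtain ⟨k, rfl⟩ := hr
    rw [hs' _ ⟨k, rfl⟩, coords_apply_chart]
    by_cases hk : k = i
    · subst hk; simp
    · have : (idx e) k ≠ (idx e) i := fun h => hk ((idx_injective e) h)
      simp [hk, this]
  · have : r ≠ (idx e) i := fun h => hr ⟨i, h.symm⟩
    simp [this, hs r hr]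

lemma point_eq_chart (e : P.ChartIndex) (z : P.HomogCoord)
    (h : ∀ r, r ∉ Set.range (idx e) → homogVal z r ≠ 0) : P.point z = P.chart e (toChart e (homogVal z)) := by
  classical
  rw [chart_eq_point, point_eq_point_iff]
  simp only [homogVal_mkHomog]
  set s : ι → ℂˣ := fun r => if hr : r ∈ Set.range (idx e) then 1 else Units.mk0 (homogVal z r) (h r hr)
  have hs : ∀ r, r ∉ Set.range (idx e) → (s r : ℂ) = homogVal z r := fun r hr => by
    simp only [s, dif_neg hr, Units.val_mk0]
  have hs' : ∀ r ∈ Set.range (idx e), s r = 1 := fun r hr => by simp only [s, dif_pos hr]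
  set w : Fin n → ℂˣ := fun i => ∏ r, s r ^ coords e r i
  -- The factor s⁻¹ normalises the coordinates off the chart to 1; the factor w compensates on the
  -- chart so that the product lies in the kernel, by `sum_coords_mul`.
  refine ⟨fun r => (s r)⁻¹ * Function.extend (idx e) w 1 r, ?_, fun r => ?_⟩
  · rw [mem_kernelTorus]
    intro j
    simp only [mul_zpow, Finset.prod_mul_distrib]
    rw [prod_extend]
    have : ∏ i, w i ^ P.normal (idx e i) j = ∏ r, s r ^ P.normal r j := by
      simp only [w, ← Finset.prod_zpow, ← zpow_mul]
      rw [Finset.prod_comm]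
      refine Finset.prod_congr rfl fun r _ => ?_
      rw [prod_zpow_eq_zpow_sum, sum_coords_mul]
    rw [this, ← Finset.prod_mul_distrib]
    simp
  · beta_reduce
    by_cases hr : r ∈ Set.range (idx e)
    · obtain ⟨i, rfl⟩ := hr
      rw [homog_apply, (idx_injective e).extend_apply, hs' _ ⟨i, rfl⟩, toChart_apply_of_mem i s hs hs']
      simp only [w]
      push_cast; ring
    · rw [homog_of_notMem e _ hr, Function.extend_apply' _ _ _ fun h => hr h]
      simp [hs r hr, h r hr]

/-- The normals at a vertex form a ℤ-basis, so there are exactly n facets to order. -/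
lemma exists_chartIndex {p : Fin n → ℝ} (hp : p ∈ P.vertices) :
    ∃ e : P.ChartIndex, Set.range (idx e) = P.facetsAt p := by
  classical
  obtain ⟨h1, h2⟩ := P.basis p hp
  have h3 : Set.range (fun r : {r // pair (P.normal r) p = P.offset r} => P.normal r) =
      P.normal '' {r | pair (P.normal r) p = P.offset r} := by
    rw [Set.image_eq_range]; rfl
  have b := Module.Basis.mk h1 (by rw [h3, h2])
  have h4 := Module.finrank_eq_card_basis b
  rw [Module.finrank_fin_fun] at h4
  let f := (Fintype.equivFinOfCardEq h4.symm).symm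
  let g : Fin n → ι := fun i => (f i).1
  have hg : Set.range g = P.facetsAt p := by
    ext r
    constructor
    · rintro ⟨i, rfl⟩; exact (f i).2
    · intro hr; exact ⟨f.symm ⟨r, hr⟩, by simp only [g, Equiv.apply_symm_apply]⟩
  exact ⟨⟨g, fun i j hij => f.injective (Subtype.ext hij), p, hp, hg⟩, hg⟩

lemma exists_eq_chart (x : P.ToricManifold) : ∃ e z, x = P.chart e z := by
  obtain ⟨z, rfl⟩ := Quotient.exists_rep x
  obtain ⟨p, hp, hz⟩ := homogVal_spec z
  obtain ⟨e, he⟩ := exists_chartIndex hp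
  refine ⟨e, _, point_eq_chart e z fun r hr h0 => hr ?_⟩
  rw [he]; exact hz r h0

/-- A kernel element equal to 1 off the chart is killed by an integrally invertible matrix of
exponents, so it is trivial. -/
lemma chart_injective (e : P.ChartIndex) : Function.Injective (P.chart e) := by
  intro z w h
  rw [chart_eq_point, chart_eq_point, point_eq_point_iff] at h
  simp only [homogVal_mkHomog] at h
  obtain ⟨t, ht, h⟩ := h
  have h1 : ∀ r, r ∉ Set.range (idx e) → t r = 1 := by
    intro r hr
    have := h r
    simp only [homog_of_notMem e _ hr, mul_one] at this
    exact Units.ext this.symm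
  have h2 : ∀ i, t (idx e i) = 1 := by
    intro i
    set u : Fin n → ℂˣ := fun i => t (idx e i)
    have h3 : t = Function.extend (idx e) u 1 := by
      ext1 r
      by_cases hr : r ∈ Set.range (idx e)
      · obtain ⟨i, rfl⟩ := hr
        rw [(idx_injective e).extend_apply]
      · rw [Function.extend_apply' _ _ _ fun h => hr h, h1 r hr]; rfl
    have h4 : ∀ j, ∏ i, u i ^ P.normal (idx e i) j = 1 := fun j => by
      rw [← prod_extend e u fun r => P.normal r j, ← h3]; exact ht j
    have h5 : ∏ j, (∏ k, u k ^ P.normal (idx e k) j) ^ ((chartMatrix e)⁻¹ j i) = u i := by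
      simp only [← Finset.prod_zpow, ← zpow_mul]
      rw [Finset.prod_comm]
      have : ∀ k, ∑ j, P.normal (idx e k) j * (chartMatrix e)⁻¹ j i = if k = i then 1 else 0 := by
        intro k
        rw [← coords_apply_chart e, coords, Matrix.mul_apply]; rfl
      simp only [prod_zpow_eq_zpow_sum, this]
      simp [apply_ite]
    simp only [h4, one_zpow, Finset.prod_const_one] at h5
    exact h5.symm
  ext i
  have := h (idx e i)
  simpa [h2 i] using this.symm

lemma continuous_homog (e : P.ChartIndex) : Continuous (homog e) := by
  refine continuous_pi fun r => ?_
  by_cases hr : r ∈ Set.range (idx e)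
  · obtain ⟨i, rfl⟩ := hr
    simpa using continuous_apply i
  · simp only [homog_of_notMem e _ hr]; exact continuous_const

lemma continuous_chart (e : P.ChartIndex) : Continuous (P.chart e) := by
  have h : Continuous fun z : Fin n → ℂ => mkHomog (homog e z)
      (exists_homogCoord e (homog_ne_zero_of_notMem e z)) :=
    Continuous.subtype_mk (continuous_homog e) _
  exact (continuous_quotient_mk' (s := P.homogSetoid)).comp h

/-- Near any homogeneous point the quotient map factors through `toChart`, which is continuous where
the coordinates off the chart do not vanish; openness of the charts is not needed. -/
lemma continuous_of_comp_chart {Y : Type*} [TopologicalSpace Y] {f : P.ToricManifold → Y}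
    (hf : ∀ e, Continuous fun z => f (P.chart e z)) : Continuous f := by
  have hq : Topology.IsQuotientMap P.point := isQuotientMap_quotient_mk'
  rw [hq.continuous_iff]
  · rw [continuous_iff_continuousAt]
    intro (z : P.HomogCoord)
    obtain ⟨p, hp, hz⟩ := homogVal_spec z
    obtain ⟨e, he⟩ := exists_chartIndex hp
    have hz' : ∀ r, r ∉ Set.range (idx e) → homogVal z r ≠ 0 := fun r hr h0 => hr (he ▸ hz r h0)
    have h1 : ContinuousAt (fun w : P.HomogCoord => toChart e (homogVal w)) z := by
      refine continuousAt_pi.2 fun i => ?_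
      refine tendsto_finsetProd _ fun r _ => ?_
      have hc : ContinuousAt (fun w : P.HomogCoord => homogVal w r) z :=
        ((continuous_apply r).comp continuous_homogVal).continuousAt
      refine hc.zpow₀ _ ?_
      -- A coordinate that may vanish has exponent 0 or 1, so its power is still continuous; the
      -- others are nonzero at z.
      by_cases hr : r ∈ Set.range (idx e)
      · obtain ⟨k, rfl⟩ := hr
        right
        rw [coords_apply_chart]; split_ifs <;> simp
      · exact Or.inl (hz' r hr)
    have h2 : ContinuousAt (fun w => f (P.chart e (toChart e (homogVal w)))) z :=
      ContinuousAt.comp (f := fun w : P.HomogCoord => toChart e (homogVal w))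
        (g := fun z => f (P.chart e z)) (hf e).continuousAt h1
    refine h2.congr ?_
    have h3 : ∀ᶠ w : P.HomogCoord in 𝓝 z, ∀ r, r ∉ Set.range (idx e) → homogVal w r ≠ 0 := by
      rw [Filter.eventually_all]
      intro r
      by_cases hr : r ∈ Set.range (idx e)
      · exact Filter.Eventually.of_forall fun _ h => absurd hr h
      · have hc : ContinuousAt (fun w : P.HomogCoord => homogVal w r) z :=
          ((continuous_apply r).comp continuous_homogVal).continuousAt
        exact (hc.eventually_ne (hz' r hr)).mono fun w h _ => h
    filter_upwards [h3] with w hw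
    simp only [Function.comp_apply]
    rw [point_eq_chart e w hw]

/-- The change of coordinates between two charts. -/
def transition (e e' : P.ChartIndex) (z : Fin n → ℂ) (i : Fin n) : ℂ :=
  ∏ k, z k ^ coords e' (idx e k) i

lemma homog_ne_zero (e : P.ChartIndex) {z : Fin n → ℂ} (hz : ∀ i, z i ≠ 0) (r : ι) :
    homog e z r ≠ 0 := by
  by_cases hr : r ∈ Set.range (idx e)
  · obtain ⟨k, rfl⟩ := hr
    simpa using hz k
  · exact homog_ne_zero_of_notMem e z r hr

lemma chart_transition (e e' : P.ChartIndex) {z : Fin n → ℂ} (hz : ∀ i, z i ≠ 0) :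
    P.chart e' (transition e e' z) = P.chart e z := by
  rw [chart_eq_point e z, point_eq_chart e' (mkHomog (homog e z) _)
    fun r _ => homog_ne_zero e hz r]
  congr 1
  ext i
  exact (prod_homog e z fun r => coords e' r i).symm

lemma transition_ne_zero (e e' : P.ChartIndex) {z : Fin n → ℂ} (hz : ∀ i, z i ≠ 0) (i : Fin n) :
    transition e e' z i ≠ 0 :=
  Finset.prod_ne_zero_iff.2 fun k _ => zpow_ne_zero _ (hz k)

lemma eq_transition {e e' : P.ChartIndex} {z w : Fin n → ℂ} (hz : ∀ i, z i ≠ 0)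
    (h : P.chart e z = P.chart e' w) : w = transition e e' z := by
  apply chart_injective e'
  rw [chart_transition e e' hz, h]

lemma ne_zero_of_chart_eq {e e' : P.ChartIndex} {z w : Fin n → ℂ} (hz : ∀ i, z i ≠ 0)
    (h : P.chart e z = P.chart e' w) (i : Fin n) : w i ≠ 0 := by
  rw [eq_transition hz h]; exact transition_ne_zero e e' hz i

end DelzantPolytope

/-! ### Geometry of the polytope and the cones at its vertices -/

section Pair

variable {n : ℕ}

lemma pair_add (l : Fin n → ℤ) (x y : Fin n → ℝ) : pair l (x + y) = pair l x + pair l y := by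
  simp [pair, mul_add, Finset.sum_add_distrib]

lemma pair_smul (l : Fin n → ℤ) (a : ℝ) (x : Fin n → ℝ) : pair l (a • x) = a * pair l x := by
  simp only [pair, Pi.smul_apply, smul_eq_mul, Finset.mul_sum]
  exact Finset.sum_congr rfl fun i _ => by ring

lemma pair_sub (l : Fin n → ℤ) (x y : Fin n → ℝ) : pair l (x - y) = pair l x - pair l y := by
  simp [pair, mul_sub, Finset.sum_sub_distrib]

lemma continuous_pair (l : Fin n → ℤ) : Continuous (pair l) := by
  unfold pair; fun_prop

end Pair

namespace DelzantPolytope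

variable {n : ℕ} {ι : Type*} [Fintype ι] {P : DelzantPolytope n ι}

lemma combo_mem_carrier {x y : Fin n → ℝ} (hx : x ∈ P.closedCarrier) (hy : y ∈ P.carrier) {t : ℝ}
    (h0 : 0 < t) (h1 : t ≤ 1) : (1 - t) • x + t • y ∈ P.carrier := by
  intro r
  rw [pair_add, pair_smul, pair_smul]
  have h2 := hx r
  have h3 := hy r
  nlinarith [mul_le_mul_of_nonneg_left h2 (sub_nonneg.2 h1), mul_lt_mul_of_pos_left h3 h0]

lemma closedCarrier_subset_closure : P.closedCarrier ⊆ closure P.carrier := by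
  intro x hx
  obtain ⟨y, hy⟩ := P.nonempty
  have h1 : Filter.Tendsto (fun t : ℝ => (1 - t) • x + t • y) (𝓝[>] 0) (𝓝 x) := by
    have : Continuous fun t : ℝ => (1 - t) • x + t • y := by fun_prop
    have h2 := this.tendsto 0
    simp only [sub_zero, one_smul, zero_smul, add_zero] at h2
    exact h2.mono_left nhdsWithin_le_nhds
  refine mem_closure_of_tendsto h1 ?_
  filter_upwards [Ioo_mem_nhdsGT (zero_lt_one' ℝ)] with t ht
  exact combo_mem_carrier hx hy ht.1 ht.2.le

lemma isCompact_closedCarrier : IsCompact P.closedCarrier := by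
  refine Metric.isCompact_of_isClosed_isBounded ?_
    ((Bornology.IsBounded.closure (s := P.carrier) P.bounded).subset closedCarrier_subset_closure)
  have : P.closedCarrier = ⋂ r, {x | P.offset r ≤ pair (P.normal r) x} := by
    ext x; simp [closedCarrier]
  rw [this]
  exact isClosed_iInter fun r => isClosed_le continuous_const (continuous_pair _)

lemma carrier_subset_closedCarrier : P.carrier ⊆ P.closedCarrier := fun _ hx r => (hx r).le

/-- The point of `ℝⁿ` with the given coordinates in the basis of a chart. -/
def logVec (e : P.ChartIndex) (y : Fin n → ℝ) : Fin n → ℝ :=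
  fun j => ∑ i, y i * (P.normal (idx e i) j : ℝ)

/-- The coordinates of a point of `ℝⁿ` in the basis of a chart. -/
def logCoord (e : P.ChartIndex) (ξ : Fin n → ℝ) : Fin n → ℝ :=
  fun i => ∑ j, ξ j * ((chartMatrix e)⁻¹ j i : ℝ)

lemma logVec_logCoord (e : P.ChartIndex) (ξ : Fin n → ℝ) : logVec e (logCoord e ξ) = ξ := by
  ext j
  simp only [logVec, logCoord, Finset.sum_mul]
  rw [Finset.sum_comm]
  have : ∀ k, ∑ i, ((chartMatrix e)⁻¹ k i : ℝ) * (P.normal (idx e i) j : ℝ) =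
      if k = j then 1 else 0 := by
    intro k
    have := congrFun (congrFun (Matrix.nonsing_inv_mul _ (isUnit_det_chartMatrix e)) k) j
    rw [Matrix.mul_apply, Matrix.one_apply] at this
    exact_mod_cast this
  simp only [mul_assoc, ← Finset.mul_sum, this]
  simp

lemma logCoord_logVec (e e' : P.ChartIndex) (y : Fin n → ℝ) (i : Fin n) :
    logCoord e' (logVec e y) i = ∑ k, y k * (coords e' (idx e k) i : ℝ) := by
  simp only [logVec, logCoord, Finset.sum_mul]
  rw [Finset.sum_comm]
  refine Finset.sum_congr rfl fun k _ => ?_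
  simp only [coords, Matrix.mul_apply, Matrix.of_apply]
  push_cast
  rw [Finset.mul_sum]
  exact Finset.sum_congr rfl fun j _ => by ring

lemma logCoord_logVec_self (e : P.ChartIndex) (y : Fin n → ℝ) : logCoord e (logVec e y) = y := by
  ext i
  rw [logCoord_logVec]
  simp [coords_apply_chart]

/-- The cones over the vertices of the polytope cover `ℝⁿ`. -/
lemma exists_logCoord_nonpos (ξ : Fin n → ℝ) : ∃ e : P.ChartIndex, ∀ i, logCoord e ξ i ≤ 0 := by
  set l : StrongDual ℝ (Fin n → ℝ) := ∑ j, ξ j • ContinuousLinearMap.proj (R := ℝ) j with hl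
  have hlx : ∀ x, l x = ∑ j, ξ j * x j := fun x => by simp [hl]
  -- The face where the functional ξ is maximal; any extreme point p of it is a vertex of the
  -- polytope.
  set F : Set (Fin n → ℝ) := {x ∈ P.closedCarrier | ∀ y ∈ P.closedCarrier, l y ≤ l x}
  have hF : IsExposed ℝ P.closedCarrier F := fun _ => ⟨l, rfl⟩
  have hFne : F.Nonempty := by
    obtain ⟨y, hy⟩ := P.nonempty
    obtain ⟨x, hx, hmax⟩ := isCompact_closedCarrier.exists_isMaxOn
      ⟨y, carrier_subset_closedCarrier (P := P) hy⟩ l.continuous.continuousOn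
    exact ⟨x, hx, fun y hy => hmax hy⟩
  obtain ⟨p, hp⟩ := (hF.isCompact isCompact_closedCarrier).extremePoints_nonempty hFne
  have hpv : p ∈ P.vertices := hF.isExtreme.extremePoints_subset_extremePoints hp
  have hpF : p ∈ F := hp.1
  obtain ⟨e, he⟩ := exists_chartIndex hpv
  refine ⟨e, fun i => ?_⟩
  -- The edge direction at p which leaves the i-th facet and stays in the others. Moving along it
  -- remains in the polytope, so ξ cannot increase; its value on v is the i-th coordinate.
  set v : Fin n → ℝ := fun j => ((chartMatrix e)⁻¹ j i : ℝ)
  have hv : ∀ r, pair (P.normal r) v = coords e r i := by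
    intro r
    simp only [pair, v, coords, Matrix.mul_apply, Matrix.of_apply]
    push_cast; rfl
  have hev : ∀ᶠ ε : ℝ in 𝓝[>] 0, ∀ r, P.offset r ≤ pair (P.normal r) (p + ε • v) := by
    rw [Filter.eventually_all]
    intro r
    by_cases hr : r ∈ Set.range (idx e)
    · have hr' : pair (P.normal r) p = P.offset r := by rw [he] at hr; exact hr
      obtain ⟨k, rfl⟩ := hr
      filter_upwards [self_mem_nhdsWithin] with ε hε
      have hε' : (0 : ℝ) < ε := hε
      rw [pair_add, pair_smul, hr', hv, coords_apply_chart]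
      split_ifs
      · push_cast; linarith
      · simp
    · have hr' : P.offset r < pair (P.normal r) p :=
        lt_of_le_of_ne (hpF.1 r) fun h => hr (by rw [he]; exact h.symm)
      have hc : Continuous fun ε : ℝ => pair (P.normal r) (p + ε • v) :=
        (continuous_pair _).comp (by fun_prop)
      have h2 := hc.tendsto 0
      simp only [zero_smul, add_zero] at h2
      exact ((h2.mono_left nhdsWithin_le_nhds).eventually_const_lt hr').mono fun _ h => h.le
  obtain ⟨ε, hε, hε0⟩ := (hev.and self_mem_nhdsWithin).exists
  have h3 := hpF.2 _ hε
  rw [map_add, map_smul, smul_eq_mul] at h3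
  have hε0' : (0 : ℝ) < ε := hε0
  have h4 : l v ≤ 0 := by
    by_contra h
    push Not at h
    nlinarith [mul_pos hε0' h]
  rwa [hlx] at h4

/-! ### Symmetries and rotations acting on facets, charts and homogeneous coordinates -/

/-- The action on facets of a symmetry of the polytope which fixes the centre. -/
lemma exists_facet_perm {ν₀ : Fin n → ℝ} (hP : P.IsFanoWithCentre ν₀)
    {γ : (Fin n → ℝ) ≃ᵃ[ℝ] (Fin n → ℝ)} (hγ : γ '' P.carrier = P.carrier) (hν : γ ν₀ = ν₀) :
    ∃ π : Equiv.Perm ι, ∀ r x,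
      pair (P.normal (π r)) (γ x) - P.offset (π r) = pair (P.normal r) x - P.offset r := by
  have hν0 : ν₀ ∈ P.carrier := fun r => by linarith [hP r]
  have key : ∀ r, ∃ s, ∀ x,
      pair (P.normal s) (γ x) - P.offset s = pair (P.normal r) x - P.offset r := by
    intro r
    obtain ⟨x₀, hx₀, hx₀'⟩ := P.facet r
    -- A relative interior point of facet r stays on the boundary, so its image lies on some facet
    -- s.
    have h1 : γ x₀ ∉ P.carrier := by
      rw [← hγ]
      rintro ⟨x, hx, hxx⟩
      rw [γ.injective hxx] at hx
      exact absurd (hx r) (by rw [hx₀]; exact lt_irrefl _)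
    have h2 : ∃ s, pair (P.normal s) (γ x₀) ≤ P.offset s := by
      by_contra h
      push Not at h
      exact h1 h
    obtain ⟨s, hs⟩ := h2
    refine ⟨s, ?_⟩
    have hnonneg : ∀ x ∈ P.closedCarrier, 0 ≤ pair (P.normal s) (γ x) - P.offset s := by
      intro x hx
      have hcl : x ∈ closure P.carrier := closedCarrier_subset_closure hx
      have hclosed : IsClosed {x | 0 ≤ pair (P.normal s) (γ x) - P.offset s} := by
        refine isClosed_le continuous_const (Continuous.sub ?_ continuous_const)
        exact (continuous_pair _).comp γ.toAffineMap.continuous_of_finiteDimensional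
      refine closure_minimal ?_ hclosed hcl
      intro y hy
      have : γ y ∈ P.carrier := hγ ▸ ⟨y, hy, rfl⟩
      exact sub_nonneg.2 (this s).le
    have hlin : ∀ x w : Fin n → ℝ, pair (P.normal s) (γ (x + w)) =
        pair (P.normal s) (γ x) + pair (P.normal s) (γ.linear w) := by
      intro x w
      have := γ.map_vadd x w
      simp only [vadd_eq_add] at this
      rw [add_comm x w, this, pair_add]; ring
    have hx₀Q : x₀ ∈ P.closedCarrier := by
      intro t
      by_cases ht : t = r
      · rw [ht, hx₀]
      · exact (hx₀' t ht).le
    have hL0 : pair (P.normal s) (γ x₀) - P.offset s = 0 :=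
      le_antisymm (by linarith) (hnonneg x₀ hx₀Q)
    -- The affine function λ_s∘γ - c_s is nonnegative on the polytope and vanishes at x₀, where
    -- every small step along facet r is allowed; so its linear part vanishes on the directions of
    -- that facet.
    have hw0 : ∀ w, pair (P.normal r) w = 0 → 0 ≤ pair (P.normal s) (γ.linear w) := by
      intro w hw
      have hev : ∀ᶠ ε : ℝ in 𝓝[>] 0, ∀ t, P.offset t ≤ pair (P.normal t) (x₀ + ε • w) := by
        rw [Filter.eventually_all]
        intro t
        by_cases ht : t = r
        · refine Filter.Eventually.of_forall fun ε => ?_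
          rw [ht, pair_add, pair_smul, hw, hx₀]; simp
        · have hc : Continuous fun ε : ℝ => pair (P.normal t) (x₀ + ε • w) :=
            (continuous_pair _).comp (by fun_prop)
          have h2 := hc.tendsto 0
          simp only [zero_smul, add_zero] at h2
          exact ((h2.mono_left nhdsWithin_le_nhds).eventually_const_lt (hx₀' t ht)).mono
            fun _ h => h.le
      obtain ⟨ε, hε, hε0⟩ := (hev.and self_mem_nhdsWithin).exists
      have hε0' : (0 : ℝ) < ε := hε0
      have h3 := hnonneg _ hε
      rw [hlin, map_smul, pair_smul] at h3
      by_contra h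
      push Not at h
      nlinarith [mul_pos hε0' (neg_pos.2 h)]
    have hw : ∀ w, pair (P.normal r) w = 0 → pair (P.normal s) (γ.linear w) = 0 := by
      intro w hwr
      refine le_antisymm ?_ (hw0 w hwr)
      have h1 : pair (P.normal r) ((-1 : ℝ) • w) = 0 := by rw [pair_smul, hwr]; simp
      have := hw0 _ h1
      rw [map_smul, pair_smul] at this
      linarith
    intro x
    have hr1 := hP r
    have hs1 := hP s
    -- Both affine functions vanish on facet r and equal 1 at the fixed point ν₀, so the factor of
    -- proportionality is 1. The argument of `hw` is x - x₀ corrected by a multiple of ν₀ - x₀ to be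
    -- parallel to the facet.
    have h5 := hw ((x - x₀) - (pair (P.normal r) x - P.offset r) • (ν₀ - x₀)) (by
      rw [pair_sub, pair_smul, pair_sub, pair_sub, hx₀, hr1]; ring)
    rw [map_sub, map_smul, pair_sub, pair_smul] at h5
    have h6 := hlin x₀ (x - x₀)
    have h7 := hlin x₀ (ν₀ - x₀)
    rw [add_sub_cancel] at h6 h7
    rw [hν] at h7
    have h8 : pair (P.normal s) (γ.linear (ν₀ - x₀)) = 1 := by linarith
    rw [h8] at h5
    linarith
  choose σ hσ using key
  have hinj : Function.Injective σ := by
    intro r r' h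
    by_contra hne
    obtain ⟨x, hx, hx'⟩ := P.facet r
    have h1 := hσ r x
    have h2 := hσ r' x
    rw [h] at h1
    have := hx' r' (Ne.symm hne)
    linarith
  exact ⟨Equiv.ofBijective σ (Finite.injective_iff_bijective.1 hinj), hσ⟩

/-- The transformation `φ` of `X` is induced by the symmetry `γ` with action `π` on facets. -/
def IsInducedBy (φ : Equiv.Perm P.ToricManifold) (γ : (Fin n → ℝ) ≃ᵃ[ℝ] (Fin n → ℝ))
    (π : Equiv.Perm ι) : Prop :=
  (∀ r x, pair (P.normal (π r)) (γ x) - P.offset (π r) = pair (P.normal r) x - P.offset r) ∧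
    ∀ z w : P.HomogCoord, (∀ r, homogVal w (π r) = homogVal z r) → φ (P.point z) = P.point w

/-- The transformation `φ` of `X` is given by the rotation `u` of homogeneous coordinates. -/
def IsRotation (φ : Equiv.Perm P.ToricManifold) (u : ι → Circle) : Prop :=
  ∀ z w : P.HomogCoord, (∀ r, homogVal w r = (u r : ℂ) * homogVal z r) → φ (P.point z) = P.point w

lemma mem_closedCarrier_iff {γ : (Fin n → ℝ) ≃ᵃ[ℝ] (Fin n → ℝ)} {π : Equiv.Perm ι}
    (h : ∀ r x, pair (P.normal (π r)) (γ x) - P.offset (π r) = pair (P.normal r) x - P.offset r)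
    (x : Fin n → ℝ) : γ x ∈ P.closedCarrier ↔ x ∈ P.closedCarrier := by
  constructor
  · intro hx r
    have := hx (π r)
    linarith [h r x]
  · intro hx r
    have h1 := h (π.symm r) x
    rw [Equiv.apply_symm_apply] at h1
    linarith [hx (π.symm r)]

lemma map_mem_vertices {γ : (Fin n → ℝ) ≃ᵃ[ℝ] (Fin n → ℝ)} {π : Equiv.Perm ι}
    (h : ∀ r x, pair (P.normal (π r)) (γ x) - P.offset (π r) = pair (P.normal r) x - P.offset r)
    {p : Fin n → ℝ} (hp : p ∈ P.vertices) : γ p ∈ P.vertices := by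
  have hp' : p ∈ P.closedCarrier := hp.1
  refine ⟨(mem_closedCarrier_iff h p).2 hp', fun x hx y hy hxy => ?_⟩
  have hsymm : ∀ x ∈ P.closedCarrier, γ.symm x ∈ P.closedCarrier := fun x hx =>
    (mem_closedCarrier_iff h _).1 (by simpa using hx)
  obtain ⟨a, b, ha, hb, hab, hc⟩ := hxy
  have h1 := Convex.combo_affine_apply (f := γ.symm.toAffineMap) (x := x) (y := y) hab
  rw [hc] at h1
  have h2 : p = a • γ.symm x + b • γ.symm y := by simpa using h1
  have := hp.2 (hsymm x hx) (hsymm y hy) ⟨a, b, ha, hb, hab, h2.symm⟩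
  rw [← this]; simp

lemma map_mem_facetsAt_iff {γ : (Fin n → ℝ) ≃ᵃ[ℝ] (Fin n → ℝ)} {π : Equiv.Perm ι}
    (h : ∀ r x, pair (P.normal (π r)) (γ x) - P.offset (π r) = pair (P.normal r) x - P.offset r)
    (p : Fin n → ℝ) (r : ι) : π r ∈ P.facetsAt (γ p) ↔ r ∈ P.facetsAt p := by
  have := h r p
  simp only [facetsAt, Set.mem_ofPred_eq]
  constructor <;> intro h1 <;> linarith

/-- The chart at the image of a vertex. -/
lemma exists_chart_of_isInducedBy {φ : Equiv.Perm P.ToricManifold}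
    {γ : (Fin n → ℝ) ≃ᵃ[ℝ] (Fin n → ℝ)} {π : Equiv.Perm ι} (h : IsInducedBy φ γ π)
    (e : P.ChartIndex) :
    ∃ e' : P.ChartIndex, (∀ i, idx e' i = π (idx e i)) ∧ ∀ z, φ (P.chart e z) = P.chart e' z := by
  obtain ⟨p, hp, hr⟩ := exists_range_idx e
  have hrange : Set.range (fun i => π (idx e i)) = P.facetsAt (γ p) := by
    ext r
    obtain ⟨s, rfl⟩ := π.surjective r
    rw [map_mem_facetsAt_iff h.1, ← hr]
    simp
  let e' : P.ChartIndex := ⟨fun i => π (idx e i), π.injective.comp (idx_injective e), γ p,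
    map_mem_vertices h.1 hp, hrange⟩
  have he' : ∀ i, idx e' i = π (idx e i) := fun i => rfl
  refine ⟨e', he', fun z => ?_⟩
  rw [chart_eq_point, chart_eq_point]
  refine h.2 _ _ fun r => ?_
  rw [homogVal_mkHomog, homogVal_mkHomog]
  by_cases hr' : r ∈ Set.range (idx e)
  · obtain ⟨k, rfl⟩ := hr'
    rw [homog_apply, ← he', homog_apply]
  · rw [homog_of_notMem e z hr', homog_of_notMem]
    rintro ⟨k, hk⟩
    rw [he'] at hk
    exact hr' ⟨k, π.injective hk⟩

lemma IsRotation.apply_chart {φ : Equiv.Perm P.ToricManifold} {u : ι → Circle}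
    (h : IsRotation φ u) (e : P.ChartIndex) (z : Fin n → ℂ) :
    φ (P.chart e z) = P.chart e ((fun i => ((∏ r, u r ^ coords e r i : Circle) : ℂ)) * z) := by
  have hne : ∀ r, r ∉ Set.range (idx e) → (u r : ℂ) * homog e z r ≠ 0 := fun r hr =>
    mul_ne_zero (Circle.coe_ne_zero _) (homog_ne_zero_of_notMem e z r hr)
  rw [chart_eq_point, h _ (mkHomog (fun r => (u r : ℂ) * homog e z r) (exists_homogCoord e hne))
    fun r => rfl, point_eq_chart e (mkHomog _ _) hne]
  congr 1
  ext i
  have h1 := prod_homog e z fun r => coords e r i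
  simp only [coords_apply_chart] at h1
  simp only [homogVal_mkHomog, toChart, mul_zpow, Finset.prod_mul_distrib, h1, Pi.mul_apply]
  congr 1
  · have h2 : ((∏ r, u r ^ coords e r i : Circle) : ℂ) = ∏ r, ((u r ^ coords e r i : Circle) : ℂ) :=
      map_prod Circle.coeHom _ _
    rw [h2]
    exact Finset.prod_congr rfl fun r _ => (Circle.coe_zpow _ _).symm
  · simp [apply_ite]

/-- `torusMaps` consists of permutations of X with a prescribed effect; existence is what gives
invariance under T any content. -/
lemma exists_isRotation (P : DelzantPolytope n ι) (u : ι → Circle) :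
    ∃ φ : Equiv.Perm P.ToricManifold, IsRotation φ u := by
  have hmem : ∀ (u : ι → Circle) (z : P.HomogCoord),
      ∃ p ∈ P.vertices, ∀ r, (u r : ℂ) * homogVal z r = 0 → r ∈ P.facetsAt p := by
    intro u z
    obtain ⟨p, hp, hz⟩ := homogVal_spec z
    exact ⟨p, hp, fun r hr => hz r ((mul_eq_zero.1 hr).resolve_left (Circle.coe_ne_zero _))⟩
  let σ : (ι → Circle) → P.HomogCoord → P.HomogCoord := fun u z => mkHomog _ (hmem u z)
  have hσ : ∀ u z r, homogVal (σ u z) r = (u r : ℂ) * homogVal z r := fun u z r => rfl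
  have hext : ∀ z w : P.HomogCoord, (∀ r, homogVal z r = homogVal w r) → z = w := fun z w h =>
    Subtype.ext (funext h)
  have hinv : ∀ u z, σ u⁻¹ (σ u z) = z := by
    intro u z
    refine hext _ _ fun r => ?_
    rw [hσ, hσ, ← mul_assoc, ← Circle.coe_mul]
    simp
  let E : P.HomogCoord ≃ P.HomogCoord :=
    ⟨σ u, σ u⁻¹, hinv u, fun z => by simpa using hinv u⁻¹ z⟩
  have hE : ∀ a b, P.homogSetoid.r a b ↔ P.homogSetoid.r (E a) (E b) := by
    intro a b
    constructor
    · rintro ⟨t, ht, h⟩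
      refine ⟨t, ht, fun r => ?_⟩
      have h' : homogVal b r = (t r : ℂ) * homogVal a r := h r
      change (u r : ℂ) * homogVal b r = (t r : ℂ) * ((u r : ℂ) * homogVal a r)
      rw [h']; ring
    · rintro ⟨t, ht, h⟩
      refine ⟨t, ht, fun r => ?_⟩
      have h' : (u r : ℂ) * homogVal b r = (t r : ℂ) * ((u r : ℂ) * homogVal a r) := h r
      change homogVal b r = (t r : ℂ) * homogVal a r
      refine mul_left_cancel₀ (Circle.coe_ne_zero (u r)) ?_
      rw [h']; ring
  refine ⟨Quotient.congr E hE, fun z w hw => ?_⟩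
  have : E z = w := hext _ _ fun r => (hw r).symm
  rw [← this]; rfl

/-- Every rotation of the coordinates of a chart extends to `X`. -/
lemma exists_isRotation_chart (e : P.ChartIndex) (R : Fin n → Circle) :
    ∃ φ : Equiv.Perm P.ToricManifold, ∃ u, IsRotation φ u ∧
      ∀ z, φ (P.chart e z) = P.chart e ((fun i => (R i : ℂ)) * z) := by
  obtain ⟨φ, hφ⟩ := exists_isRotation P (Function.extend (idx e) R 1)
  refine ⟨φ, _, hφ, fun z => ?_⟩
  rw [hφ.apply_chart e z]
  congr 2
  ext i
  rw [show ∏ r, Function.extend (idx e) R 1 r ^ coords e r i = R i from ?_]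
  have := prod_extend e R fun r => coords e r i
  rw [this]
  simp [coords_apply_chart, apply_ite]

/-- The linear part A carries the normal of π r to that of r by composition, and it is invertible
over ℤ; so the monomial equations of the kernel for t and for the permuted t are integral
combinations of each other. -/
lemma comp_symm_mem_kernelTorus {γ : (Fin n → ℝ) ≃ᵃ[ℝ] (Fin n → ℝ)} (hγ : P.IsSymmetry γ)
    {π : Equiv.Perm ι}
    (h : ∀ r x, pair (P.normal (π r)) (γ x) - P.offset (π r) = pair (P.normal r) x - P.offset r)
    (t : ι → ℂˣ) : t ∈ P.kernelTorus ↔ (fun r => t (π.symm r)) ∈ P.kernelTorus := by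
  obtain ⟨⟨A, b, hA⟩, -⟩ := hγ
  have h1 : ∀ r k, ∑ j, P.normal (π r) j * (A : Matrix (Fin n) (Fin n) ℤ) j k = P.normal r k := by
    intro r k
    have e1 := h r (Pi.single k 1)
    have e2 := h r 0
    rw [hA, pair_add] at e1 e2
    have e3 : pair (P.normal r) 0 = 0 := by simp [pair]
    have e4 : pair (P.normal r) (Pi.single k 1) = P.normal r k := by simp [pair, Pi.single_apply]
    have e5 : pair (P.normal (π r))
        (((A : Matrix (Fin n) (Fin n) ℤ).map fun a => (a : ℝ)) *ᵥ Pi.single k 1) =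
        ∑ j, (P.normal (π r) j : ℝ) * ((A : Matrix (Fin n) (Fin n) ℤ) j k : ℝ) := by
      simp [pair]
    have e6 : pair (P.normal (π r))
        (((A : Matrix (Fin n) (Fin n) ℤ).map fun a => (a : ℝ)) *ᵥ 0) = 0 := by
      simp [pair]
    rw [e5, e4] at e1
    rw [e6, e3] at e2
    have : ∑ j, (P.normal (π r) j : ℝ) * ((A : Matrix (Fin n) (Fin n) ℤ) j k : ℝ) =
        P.normal r k := by linarith
    exact_mod_cast this
  have h2 : ∀ r k, ∑ j, P.normal r j * ((A⁻¹ : GL (Fin n) ℤ) : Matrix (Fin n) (Fin n) ℤ) j k =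
      P.normal (π r) k := by
    have m1 : (Matrix.of fun r j => P.normal (π r) j) * (A : Matrix (Fin n) (Fin n) ℤ) =
        Matrix.of P.normal := by
      ext r k; rw [Matrix.mul_apply]; exact h1 r k
    have m2 : Matrix.of P.normal * ((A⁻¹ : GL (Fin n) ℤ) : Matrix (Fin n) (Fin n) ℤ) =
        Matrix.of fun r j => P.normal (π r) j := by
      rw [← m1, Matrix.mul_assoc, ← Units.val_mul]
      simp
    intro r k
    have := congrFun (congrFun m2 r) k
    rwa [Matrix.mul_apply] at this
  have h3 : ∀ j, ∏ r, t (π.symm r) ^ P.normal r j = ∏ r, t r ^ P.normal (π r) j := by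
    intro j
    rw [← Equiv.prod_comp π]
    simp
  have h4 : ∀ (B : Matrix (Fin n) (Fin n) ℤ) (l m : ι → Fin n → ℤ),
      (∀ r k, ∑ j, l r j * B j k = m r k) → (∀ j, ∏ r, t r ^ l r j = 1) →
        ∀ k, ∏ r, t r ^ m r k = 1 := by
    intro B l m hB hl k
    have : ∏ j, (∏ r, t r ^ l r j) ^ B j k = ∏ r, t r ^ m r k := by
      simp only [← Finset.prod_zpow, ← zpow_mul]
      rw [Finset.prod_comm]
      simp only [prod_zpow_eq_zpow_sum, hB]
    rw [← this]
    simp [hl]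
  rw [mem_kernelTorus, mem_kernelTorus]
  simp only [h3]
  exact ⟨h4 _ _ _ h2, h4 _ (fun r j => P.normal (π r) j) P.normal h1⟩

/-- Permuting homogeneous coordinates preserves the kernel orbits, hence descends to X; each γ is
thus realised in the extended torus. -/
lemma exists_isInducedBy {γ : (Fin n → ℝ) ≃ᵃ[ℝ] (Fin n → ℝ)} (hγ : P.IsSymmetry γ)
    {π : Equiv.Perm ι}
    (h : ∀ r x, pair (P.normal (π r)) (γ x) - P.offset (π r) = pair (P.normal r) x - P.offset r) :
    ∃ φ : Equiv.Perm P.ToricManifold, IsInducedBy φ γ π := by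
  have h' : ∀ r x, pair (P.normal (π.symm r)) (γ.symm x) - P.offset (π.symm r) =
      pair (P.normal r) x - P.offset r := by
    intro r x
    have := h (π.symm r) (γ.symm x)
    simpa using this.symm
  have hmem : ∀ z : P.HomogCoord,
      ∃ p ∈ P.vertices, ∀ r, homogVal z (π.symm r) = 0 → r ∈ P.facetsAt p := by
    intro z
    obtain ⟨p, hp, hz⟩ := homogVal_spec z
    refine ⟨γ p, map_mem_vertices h hp, fun r hr => ?_⟩
    have := (map_mem_facetsAt_iff h p (π.symm r)).2 (hz _ hr)
    simpa using this
  have hmem' : ∀ z : P.HomogCoord,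
      ∃ p ∈ P.vertices, ∀ r, homogVal z (π r) = 0 → r ∈ P.facetsAt p := by
    intro z
    obtain ⟨p, hp, hz⟩ := homogVal_spec z
    refine ⟨γ.symm p, map_mem_vertices h' hp, fun r hr => ?_⟩
    have := (map_mem_facetsAt_iff h' p (π r)).2 (hz _ hr)
    simpa using this
  have hext : ∀ z w : P.HomogCoord, (∀ r, homogVal z r = homogVal w r) → z = w := fun z w h =>
    Subtype.ext (funext h)
  let E : P.HomogCoord ≃ P.HomogCoord :=
    ⟨fun z => mkHomog _ (hmem z), fun z => mkHomog _ (hmem' z),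
      fun z => hext _ _ fun r => by simp, fun z => hext _ _ fun r => by simp⟩
  have hE : ∀ a b, P.homogSetoid.r a b ↔ P.homogSetoid.r (E a) (E b) := by
    intro a b
    constructor
    · rintro ⟨t, ht, h1⟩
      exact ⟨_, (comp_symm_mem_kernelTorus hγ h t).1 ht, fun r => h1 (π.symm r)⟩
    · rintro ⟨t, ht, h1⟩
      refine ⟨fun r => t (π r), (comp_symm_mem_kernelTorus hγ h _).2 (by simpa using ht),
        fun r => ?_⟩
      have : homogVal b (π.symm (π r)) = (t (π r) : ℂ) * homogVal a (π.symm (π r)) := h1 (π r)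
      simp only [Equiv.symm_apply_apply] at this
      exact this
  refine ⟨Quotient.congr E hE, h, fun z w hw => ?_⟩
  have : E z = w := hext _ _ fun r => by
    change homogVal z (π.symm r) = homogVal w r
    rw [← hw, Equiv.apply_symm_apply]
  rw [← this]; rfl

end DelzantPolytope

/-! ### Extending bounds from the open orbit by density -/

section Dense

variable {n : ℕ}

lemma dense_ne_zero : Dense {z : Fin n → ℂ | ∀ i, z i ≠ 0} := by
  have h : {z : Fin n → ℂ | ∀ i, z i ≠ 0} = Set.univ.pi fun _ => {0}ᶜ := by
    ext z; simp
  rw [h]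
  exact dense_pi _ fun i _ => dense_compl_singleton 0

lemma le_of_forall_ne_zero {f : (Fin n → ℂ) → ℝ} (hf : Continuous f) {C : ℝ}
    (h : ∀ z : Fin n → ℂ, (∀ i, z i ≠ 0) → f z ≤ C) (z : Fin n → ℂ) : f z ≤ C := by
  have h1 : IsClosed {z | f z ≤ C} := isClosed_le hf continuous_const
  exact closure_minimal (fun z hz => h z hz) h1 (dense_ne_zero z)

end Dense

/-! ### The invariant section of the anticanonical bundle and bounds on polydiscs -/

namespace DelzantPolytope

variable {n : ℕ} {ι : Type*} [Fintype ι] {P : DelzantPolytope n ι}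

lemma hasFDerivAt_transition (e e' : P.ChartIndex) {z : Fin n → ℂ} (hz : ∀ i, z i ≠ 0)
    (i : Fin n) :
    HasFDerivAt (fun z => transition e e' z i)
      (∑ k, ((coords e' (idx e k) i : ℂ) * transition e e' z i / z k) •
        (ContinuousLinearMap.proj k : (Fin n → ℂ) →L[ℂ] ℂ)) z := by
  classical
  have h1 : ∀ k ∈ (Finset.univ : Finset (Fin n)),
      HasFDerivAt (fun z : Fin n → ℂ => z k ^ coords e' (idx e k) i)
      (((coords e' (idx e k) i : ℂ) * z k ^ (coords e' (idx e k) i - 1)) •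
        (ContinuousLinearMap.proj k : (Fin n → ℂ) →L[ℂ] ℂ)) z := fun k _ =>
    HasDerivAt.comp_hasFDerivAt (h₂ := fun x : ℂ => x ^ coords e' (idx e k) i)
      (f := fun z : Fin n → ℂ => z k) z
      (hasDerivAt_zpow (coords e' (idx e k) i) (z k) (Or.inl (hz k)))
      (ContinuousLinearMap.proj (R := ℂ) (φ := fun _ : Fin n => ℂ) k).hasFDerivAt
  have h2 := HasFDerivAt.finsetProd h1
  refine h2.congr_fderiv ?_
  refine Finset.sum_congr rfl fun k _ => ?_
  rw [smul_smul]
  congr 1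
  rw [transition, ← Finset.mul_prod_erase _ _ (Finset.mem_univ k), zpow_sub_one₀ (hz k)]
  field_simp

lemma isLocalExpr_transition (e e' : P.ChartIndex) {z : Fin n → ℂ} (hz : ∀ i, z i ≠ 0) :
    IsLocalExpr P.chart id e e' (transition e e') z := by
  refine ⟨differentiableAt_pi.2 fun i => (hasFDerivAt_transition e e' hz i).differentiableAt, ?_⟩
  have h : ∀ᶠ w in 𝓝 z, ∀ i, w i ≠ 0 := by
    rw [Filter.eventually_all]
    exact fun i => (continuous_apply i).continuousAt.eventually_ne (hz i)
  filter_upwards [h] with w hw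
  rw [chart_transition e e' hw]; rfl

/-- In logarithmic coordinates a transition is linear with an integral matrix of determinant ±1, so
z_1⋯z_n ∂/∂z_1∧⋯∧∂/∂z_n agrees up to sign in all charts. -/
lemma norm_det_jacobian_transition (e e' : P.ChartIndex) {z : Fin n → ℂ} (hz : ∀ i, z i ≠ 0) :
    (∏ i, ‖z i‖) * ‖(jacobian (transition e e') z).det‖ = ∏ i, ‖transition e e' z i‖ := by
  have h1 : jacobian (transition e e') z = Matrix.diagonal (transition e e' z) *
      ((chartMatrix e * (chartMatrix e')⁻¹).map (Int.castRingHom ℂ))ᵀ *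
      Matrix.diagonal fun i => (z i)⁻¹ := by
    ext i k
    have hf : HasFDerivAt (transition e e') _ z :=
      hasFDerivAt_pi.2 fun i => hasFDerivAt_transition e e' hz i
    rw [Matrix.mul_diagonal, Matrix.diagonal_mul]
    simp only [jacobian, Matrix.of_apply, hf.fderiv, Matrix.transpose_apply, Matrix.map_apply]
    have : (chartMatrix e * (chartMatrix e')⁻¹) k i = coords e' (idx e k) i := by
      rw [coords, Matrix.mul_apply, Matrix.mul_apply]; rfl
    rw [this]
    simp [Pi.single_apply]
    field_simp
  have h2 : ‖((chartMatrix e * (chartMatrix e')⁻¹).map (Int.castRingHom ℂ)).det‖ = 1 := by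
    rw [← RingHom.mapMatrix_apply, ← RingHom.map_det]
    have : IsUnit (chartMatrix e * (chartMatrix e')⁻¹).det := by
      rw [Matrix.det_mul]
      exact (isUnit_det_chartMatrix e).mul
        (Matrix.isUnit_nonsing_inv_det _ (isUnit_det_chartMatrix e'))
    rcases Int.isUnit_iff.1 this with h | h <;> rw [h] <;> simp
  rw [h1, Matrix.det_mul, Matrix.det_mul, Matrix.det_transpose, norm_mul, norm_mul, h2,
    Matrix.det_diagonal, Matrix.det_diagonal, norm_prod, norm_prod]
  simp only [norm_inv, Finset.prod_inv_distrib]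
  have : ∏ i, ‖z i‖ ≠ 0 := Finset.prod_ne_zero_iff.2 fun i _ => norm_ne_zero_iff.2 (hz i)
  field_simp

/-- The squared norm of the torus invariant section of `K⁻¹`, in a chart. -/
def localNormSq (h : AnticanonicalMetric P.chart) (e : P.ChartIndex) (z : Fin n → ℂ) : ℝ :=
  (∏ i, ‖z i‖) ^ 2 * h.normSq e z

lemma localNormSq_eq_of_ne_zero (h : AnticanonicalMetric P.chart) {e e' : P.ChartIndex}
    {z w : Fin n → ℂ} (hz : ∀ i, z i ≠ 0) (hzw : P.chart e z = P.chart e' w) :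
    localNormSq h e z = localNormSq h e' w := by
  rw [eq_transition hz hzw, localNormSq, localNormSq, ← norm_det_jacobian_transition e e' hz,
    h.compatible e e' _ z (isLocalExpr_transition e e' hz)]
  ring

lemma exists_eq_zero_of_chart_eq {e e' : P.ChartIndex} {z w : Fin n → ℂ}
    (hzw : P.chart e z = P.chart e' w) (hz : ∃ i, z i = 0) : ∃ i, w i = 0 := by
  by_contra hw
  push Not at hw
  obtain ⟨i, hi⟩ := hz
  exact ne_zero_of_chart_eq hw hzw.symm i hi

lemma localNormSq_eq (h : AnticanonicalMetric P.chart) {e e' : P.ChartIndex}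
    {z w : Fin n → ℂ} (hzw : P.chart e z = P.chart e' w) :
    localNormSq h e z = localNormSq h e' w := by
  by_cases hz : ∃ i, z i = 0
  · obtain ⟨j, hj⟩ := exists_eq_zero_of_chart_eq hzw hz
    obtain ⟨i, hi⟩ := hz
    have h1 : ∏ i, ‖z i‖ = 0 := Finset.prod_eq_zero (Finset.mem_univ i) (by simp [hi])
    have h2 : ∏ i, ‖w i‖ = 0 := Finset.prod_eq_zero (Finset.mem_univ j) (by simp [hj])
    simp [localNormSq, h1, h2]
  · push Not at hz
    exact localNormSq_eq_of_ne_zero h hz hzw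

/-- The squared norm of the torus invariant section of `K⁻¹`. -/
def sectionNormSq (h : AnticanonicalMetric P.chart) (x : P.ToricManifold) : ℝ :=
  localNormSq h (exists_eq_chart x).choose (exists_eq_chart x).choose_spec.choose

lemma sectionNormSq_chart (h : AnticanonicalMetric P.chart) (e : P.ChartIndex) (z : Fin n → ℂ) :
    sectionNormSq h (P.chart e z) = localNormSq h e z :=
  (localNormSq_eq h (exists_eq_chart (P.chart e z)).choose_spec.choose_spec).symm

/-- Both the volume density and |∂/∂z_1∧⋯∧∂/∂z_n|² transform by |det J|², so their ratio does not
depend on the chart. Bounds on polydiscs thereby hold on entire charts. -/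
lemma det_coeff_ratio (ω₀ : KahlerMetric P.chart) (h : AnticanonicalMetric P.chart)
    {e e' : P.ChartIndex} {z w : Fin n → ℂ} (hz : ∀ i, z i ≠ 0)
    (hzw : P.chart e z = P.chart e' w) :
    (ω₀.coeff e z).det.re * h.normSq e' w = (ω₀.coeff e' w).det.re * h.normSq e z := by
  have hF := isLocalExpr_transition e e' hz
  rw [eq_transition hz hzw, h.compatible e e' _ z hF, ω₀.compatible e e' _ z hF, Matrix.det_mul,
    Matrix.det_mul, Matrix.det_transpose]
  set d := (jacobian (transition e e') z).det
  have h1 : ((jacobian (transition e e') z).map (starRingEnd ℂ)).det = (starRingEnd ℂ) d := by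
    rw [← RingHom.mapMatrix_apply, ← RingHom.map_det]
  rw [h1, mul_right_comm, Complex.mul_conj, Complex.re_ofReal_mul, Complex.normSq_eq_norm_sq]
  ring

lemma norm_transition (e e' : P.ChartIndex) {z : Fin n → ℂ} (hz : ∀ i, z i ≠ 0) (i : Fin n) :
    ‖transition e e' z i‖ =
      Real.exp (logCoord e' (logVec e fun k => Real.log ‖z k‖) i) := by
  rw [logCoord_logVec, Real.exp_sum, transition, norm_prod]
  refine Finset.prod_congr rfl fun k _ => ?_
  rw [norm_zpow, mul_comm, ← Real.rpow_intCast, Real.rpow_def_of_pos (norm_pos_iff.2 (hz k)),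
    mul_comm]

/-- Points of the open orbit lie in the closed unit polydisc of some chart. -/
lemma exists_polydisc (e : P.ChartIndex) {z : Fin n → ℂ} (hz : ∀ i, z i ≠ 0) :
    ∃ e' : P.ChartIndex, ∃ w : Fin n → ℂ, (∀ i, w i ≠ 0) ∧ (∀ i, ‖w i‖ ≤ 1) ∧
      P.chart e z = P.chart e' w ∧
      ∀ i, Real.log ‖w i‖ = logCoord e' (logVec e fun k => Real.log ‖z k‖) i := by
  obtain ⟨e', he'⟩ := exists_logCoord_nonpos (P := P) (logVec e fun k => Real.log ‖z k‖)
  refine ⟨e', transition e e' z, transition_ne_zero e e' hz, fun i => ?_,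
    (chart_transition e e' hz).symm, fun i => ?_⟩
  · rw [norm_transition e e' hz]
    exact Real.exp_le_one_iff.2 (he' i)
  · rw [norm_transition e e' hz, Real.log_exp]

/-- A bound, on the closed unit polydiscs of all charts, for a family of continuous functions. -/
lemma exists_bound_polydisc {f : P.ChartIndex → (Fin n → ℂ) → ℝ} (hf : ∀ e, Continuous (f e)) :
    ∃ C, 0 ≤ C ∧ ∀ e z, (∀ i, ‖z i‖ ≤ 1) → |f e z| ≤ C := by
  have h1 : ∀ e, ∃ C, ∀ z : Fin n → ℂ, (∀ i, ‖z i‖ ≤ 1) → |f e z| ≤ C := by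
    intro e
    obtain ⟨C, hC⟩ := (isCompact_closedBall (0 : Fin n → ℂ) 1).exists_bound_of_continuousOn
      (hf e).continuousOn
    refine ⟨C, fun z hz => hC z ?_⟩
    rw [mem_closedBall_zero_iff]
    exact (pi_norm_le_iff_of_nonneg zero_le_one).2 hz
  choose C hC using h1
  obtain ⟨M, hM⟩ := (Set.finite_range C).bddAbove
  refine ⟨max M 0, le_max_right _ _, fun e z hz => (hC e z hz).trans ?_⟩
  exact (hM ⟨e, rfl⟩).trans (le_max_left _ _)

lemma smooth_log_normSq (h : AnticanonicalMetric P.chart) (e : P.ChartIndex) :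
    ContDiff ℝ ∞ fun z => Real.log (h.normSq e z) :=
  (h.smooth e).log fun z => (h.pos e z).ne'

lemma log_localNormSq (h : AnticanonicalMetric P.chart) (e : P.ChartIndex) {z : Fin n → ℂ}
    (hz : ∀ i, z i ≠ 0) : Real.log (localNormSq h e z) =
      2 * ∑ i, Real.log ‖z i‖ + Real.log (h.normSq e z) := by
  have h0 : ∀ i, ‖z i‖ ≠ 0 := fun i => norm_ne_zero_iff.2 (hz i)
  have h1 : ∏ i, ‖z i‖ ≠ 0 := Finset.prod_ne_zero_iff.2 fun i _ => h0 i
  rw [localNormSq, Real.log_mul (pow_ne_zero 2 h1) (h.pos e z).ne', Real.log_pow,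
    Real.log_prod fun i _ => h0 i]
  norm_cast

/-! ### Invariance of the Hermitian metric under the extended torus -/

/-- A transformation of `X` which maps charts to charts, up to rotations. -/
def PermutesCharts (φ : Equiv.Perm P.ToricManifold) : Prop :=
  ∀ e : P.ChartIndex, ∃ e' : P.ChartIndex, ∃ R : Fin n → ℂ, (∀ i, ‖R i‖ = 1) ∧
    ∀ z, φ (P.chart e z) = P.chart e' (R * z)

/-- Multiplication by a vector, as a continuous linear map. -/
def mulCLM (R : Fin n → ℂ) : (Fin n → ℂ) →L[ℂ] (Fin n → ℂ) :=
  ContinuousLinearMap.pi fun i => R i • ContinuousLinearMap.proj i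

@[simp] lemma mulCLM_apply (R z : Fin n → ℂ) : mulCLM R z = R * z := by
  ext i; simp [mulCLM]

lemma jacobian_mulCLM (R z : Fin n → ℂ) : jacobian (mulCLM R) z = Matrix.diagonal R := by
  ext i k
  simp only [jacobian, Matrix.of_apply, ContinuousLinearMap.fderiv, mulCLM_apply, Pi.mul_apply,
    Matrix.diagonal_apply, Pi.single_apply, mul_ite, mul_one, mul_zero]

/-- The Hermitian metric changes by a constant factor under an automorphism which preserves its
curvature. -/
lemma log_normSq_sub_eq (ω₀ : KahlerMetric P.chart) (h : AnticanonicalMetric P.chart)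
    (hω : ∀ e z, ω₀.coeff e z = -complexHessian (fun w => Real.log (h.normSq e w)) z)
    {φ : Equiv.Perm P.ToricManifold} (hφ : PullbackEq P.chart ω₀.coeff φ)
    (hperm : PermutesCharts φ) {e e' : P.ChartIndex} {R : Fin n → ℂ} (hR : ∀ i, ‖R i‖ = 1)
    (he : ∀ z, φ (P.chart e z) = P.chart e' (R * z)) (z : Fin n → ℂ) :
    Real.log (h.normSq e' (R * z)) - Real.log (h.normSq e z) =
      Real.log (h.normSq e' 0) - Real.log (h.normSq e 0) := by
  set L : (Fin n → ℂ) →L[ℝ] (Fin n → ℂ) := (mulCLM R).restrictScalars ℝ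
  have hL : ∀ z, L z = R * z := fun z => mulCLM_apply R z
  set f : P.ChartIndex → (Fin n → ℂ) → ℝ := fun e z => Real.log (h.normSq e z)
  have hf : ∀ e, ContDiff ℝ ∞ (f e) := smooth_log_normSq h
  have hfL : ContDiff ℝ ∞ fun z => f e' (L z) := (hf e').comp L.contDiff
  have hlevi : ∀ z b, levi (f e) z b = levi (f e') (R * z) (R * b) := by
    intro z b
    have h1 : IsLocalExpr P.chart φ e e' (mulCLM R) z :=
      ⟨(mulCLM R).differentiableAt, Filter.Eventually.of_forall fun w => by
        rw [he, mulCLM_apply]⟩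
    have h2 := hφ e e' _ z h1
    rw [hω, hω, mul_neg, neg_mul, neg_inj, jacobian_mulCLM, mulCLM_apply] at h2
    rw [levi_eq_of_complexHessian (hf e) (hf e') _ h2]
    congr 1
    ext i
    rw [Matrix.mulVec_diagonal]; rfl
  have hleviL : ∀ z b, levi (fun z => f e' (L z)) z b = levi (f e') (R * z) (R * b) := by
    intro z b
    have : L (Complex.I • b) = Complex.I • L b := (mulCLM R).map_smul _ _
    simp only [levi, hess_comp_continuousLinearMap (hf e'), this]
    simp only [hL]
  -- Pluriharmonic, since φ preserves the curvature; Liouville applies once it is bounded on ℂⁿ.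
  set v : (Fin n → ℂ) → ℝ := fun z => f e' (L z) + -f e z
  have hv : ContDiff ℝ ∞ v := hfL.add (hf e).neg
  have hv0 : ∀ z b, levi v z b = 0 := by
    intro z b
    rw [levi_add hfL (hf e).neg, levi_neg, hleviL, hlevi]; ring
  obtain ⟨C, hC0, hC⟩ := exists_bound_polydisc (P := P) (f := f) fun e => (hf e).continuous
  have hnorm : ∀ {R : Fin n → ℂ}, (∀ i, ‖R i‖ = 1) → ∀ z : Fin n → ℂ, ∀ i,
      ‖(R * z) i‖ = ‖z i‖ := fun hR z i => by rw [Pi.mul_apply, norm_mul, hR, one_mul]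
  have hne : ∀ {R : Fin n → ℂ}, (∀ i, ‖R i‖ = 1) → ∀ {z : Fin n → ℂ}, (∀ i, z i ≠ 0) →
      ∀ i, (R * z) i ≠ 0 := fun hR z hz i => by
    rw [← norm_ne_zero_iff, hnorm hR]; exact norm_ne_zero_iff.2 (hz i)
  -- This difference is the change of log|s|² under φ, as rotations preserve the |z_i|. It can
  -- therefore be read in a chart where the point lies in the unit polydisc, and there both metrics
  -- are bounded by C.
  have hb1 : ∀ z : Fin n → ℂ, (∀ i, z i ≠ 0) → |v z| ≤ 2 * C := by
    intro z hz
    obtain ⟨e₁, w, hw0, hw1, hzw, -⟩ := exists_polydisc e hz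
    obtain ⟨e₂, R', hR', he₂⟩ := hperm e₁
    have h1 := localNormSq_eq h hzw
    have h2 : P.chart e' (R * z) = P.chart e₂ (R' * w) := by rw [← he, ← he₂, hzw]
    have h3 := localNormSq_eq h h2
    have h1' := congrArg Real.log h1
    have h3' := congrArg Real.log h3
    rw [log_localNormSq h _ hz, log_localNormSq h _ hw0] at h1'
    rw [log_localNormSq h _ (hne hR hz), log_localNormSq h _ (hne hR' hw0)] at h3'
    simp only [hnorm hR, hnorm hR'] at h3'
    have h4 : v z = f e₂ (R' * w) - f e₁ w := by
      simp only [v, f, hL]; linarith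
    rw [h4]
    have h5 := hC e₂ (R' * w) fun i => by rw [hnorm hR']; exact hw1 i
    have h6 := hC e₁ w hw1
    exact (abs_sub _ _).trans (by linarith)
  have hb : ∀ z, |v z| ≤ 2 * C := le_of_forall_ne_zero hv.continuous.abs hb1
  have := eq_of_levi_eq_zero_of_bounded hv hv0 hb z
  simp only [v, hL, mul_zero, f] at this
  linarith

lemma IsRotation.permutesCharts {φ : Equiv.Perm P.ToricManifold} {u : ι → Circle}
    (h : IsRotation φ u) : PermutesCharts φ := fun e =>
  ⟨e, _, fun _ => Circle.norm_coe _, h.apply_chart e⟩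

lemma IsInducedBy.permutesCharts {φ : Equiv.Perm P.ToricManifold}
    {γ : (Fin n → ℝ) ≃ᵃ[ℝ] (Fin n → ℝ)} {π : Equiv.Perm ι} (h : IsInducedBy φ γ π) :
    PermutesCharts φ := fun e => by
  obtain ⟨e', -, he'⟩ := exists_chart_of_isInducedBy h e
  exact ⟨e', 1, fun _ => by simp, fun z => by rw [he', one_mul]⟩

/-- Transitions are monomial, so all charts share one unit point. -/
lemma chart_one_eq (e e' : P.ChartIndex) : P.chart e 1 = P.chart e' 1 := by
  have : transition e e' 1 = 1 := by ext i; simp [transition]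
  rw [← chart_transition e e' (z := 1) fun i => one_ne_zero, this]

/-- The norm of the torus invariant section is invariant under the extended torus. -/
lemma sectionNormSq_invariant (ω₀ : KahlerMetric P.chart) (h : AnticanonicalMetric P.chart)
    (hω : ∀ e z, ω₀.coeff e z = -complexHessian (fun w => Real.log (h.normSq e w)) z)
    (Γ : Subgroup ((Fin n → ℝ) ≃ᵃ[ℝ] (Fin n → ℝ))) (hinv : ω₀.IsInvariant (P.extendedTorus Γ))
    {φ : Equiv.Perm P.ToricManifold} (hφ : φ ∈ P.extendedTorus Γ) (x : P.ToricManifold) :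
    sectionNormSq h (φ x) = sectionNormSq h x := by
  -- The metrics differ by a constant factor, so agreement at one point suffices: the chart's origin
  -- for rotations, the common unit point for symmetries.
  have hconst : ∀ {φ : Equiv.Perm P.ToricManifold}, PullbackEq P.chart ω₀.coeff φ →
      PermutesCharts φ → ∀ {e e' : P.ChartIndex} {R : Fin n → ℂ}, (∀ i, ‖R i‖ = 1) →
      (∀ z, φ (P.chart e z) = P.chart e' (R * z)) →
      (∃ z, h.normSq e' (R * z) = h.normSq e z) → ∀ z,
      sectionNormSq h (φ (P.chart e z)) = sectionNormSq h (P.chart e z) := by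
    rintro φ hφ hp e e' R hR he ⟨z₀, hz₀⟩ z
    have h1 := log_normSq_sub_eq ω₀ h hω hφ hp hR he z
    have h2 := log_normSq_sub_eq ω₀ h hω hφ hp hR he z₀
    rw [hz₀, sub_self] at h2
    have h3 : h.normSq e' (R * z) = h.normSq e z :=
      Real.log_injOn_pos (h.pos _ _) (h.pos _ _) (by linarith)
    rw [he, sectionNormSq_chart, sectionNormSq_chart, localNormSq, localNormSq, h3]
    simp [hR]
  induction hφ using Subgroup.closure_induction generalizing x with
  | mem φ hmem =>
    have hpull := hinv φ (Subgroup.subset_closure hmem)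
    obtain ⟨e, z, rfl⟩ := exists_eq_chart x
    rcases hmem with ⟨u, hu⟩ | ⟨γ, hγ, π, hπ, hφ⟩
    · have hrot : IsRotation φ u := hu
      exact hconst hpull hrot.permutesCharts (fun i => Circle.norm_coe _) (hrot.apply_chart e)
        ⟨0, by rw [mul_zero]⟩ z
    · have hind : IsInducedBy φ γ π := ⟨hπ, hφ⟩
      obtain ⟨e', -, he'⟩ := exists_chart_of_isInducedBy hind e
      refine hconst hpull hind.permutesCharts (R := 1) (e' := e') (fun i => by simp)
        (fun z => by rw [he', one_mul]) ⟨1, ?_⟩ z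
      have h1 := localNormSq_eq h (chart_one_eq e e')
      simpa [localNormSq] using h1.symm
  | one => rfl
  | mul φ ψ _ _ h1 h2 => rw [Equiv.Perm.mul_apply, h1, h2]
  | inv φ _ h1 => rw [← h1 (φ⁻¹ x)]; simp

end DelzantPolytope

/-! ### Convex functions bounded along a ray -/

section Convexity

/-- A convex function which is bounded above along a ray is maximal at the origin of the ray. -/
lemma ConvexOn.apply_le_of_ray_bounded {E : Type*} [AddCommGroup E] [Module ℝ E] {f : E → ℝ}
    (hf : ConvexOn ℝ Set.univ f) (y : E) {M : ℝ} (hM : ∀ t : ℝ, 0 ≤ t → f (t • y) ≤ M) :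
    f y ≤ f 0 := by
  refine le_of_forall_pos_le_add fun ε hε => ?_
  have hD : 0 ≤ M - f 0 := by have := hM 0 le_rfl; rw [zero_smul] at this; linarith
  -- Chosen so that (M - f 0)/T ≤ ε in the convexity inequality between 0 and T • y.
  set T : ℝ := 1 + (M - f 0) / ε
  have hq : 0 ≤ (M - f 0) / ε := by positivity
  have hT : 1 ≤ T := by linarith
  have hT0 : 0 < T := by linarith
  have h1 : 0 ≤ 1 - T⁻¹ := sub_nonneg.2 (inv_le_one_of_one_le₀ hT)
  have h2 := hf.2 (Set.mem_univ (0 : E)) (Set.mem_univ (T • y)) h1 (inv_nonneg.2 hT0.le)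
    (by ring)
  rw [smul_zero, zero_add, inv_smul_smul₀ hT0.ne'] at h2
  simp only [smul_eq_mul] at h2
  have h3 := mul_le_mul_of_nonneg_left (hM T hT0.le) (inv_nonneg.2 hT0.le)
  have h4 : T⁻¹ * (M - f 0) ≤ ε := by
    rw [inv_mul_le_iff₀ hT0]
    have : T * ε = ε + (M - f 0) := by simp only [T]; field_simp
    linarith
  nlinarith

end Convexity

/-! ### Convex potentials on the open orbit: minimum and upper bound -/

namespace DelzantPolytope

variable {n : ℕ} {ι : Type*} [Fintype ι] {P : DelzantPolytope n ι}

lemma isOpen_carrier : IsOpen P.carrier := by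
  have : P.carrier = ⋂ r, {x | P.offset r < pair (P.normal r) x} := by
    ext x; simp [carrier]
  rw [this]
  exact isOpen_iInter_of_finite fun r => isOpen_lt continuous_const (continuous_pair _)

/-- If the centre is the only fixed point, the linear parts average to zero. -/
lemma sum_linear_eq_zero {ν₀ : Fin n → ℝ} {Γ : Subgroup ((Fin n → ℝ) ≃ᵃ[ℝ] (Fin n → ℝ))}
    [Fintype Γ] (hfix : {x | x ∈ P.carrier ∧ ∀ γ ∈ Γ, γ x = x} = {ν₀}) (v : Fin n → ℝ) :
    ∑ γ : Γ, (γ : (Fin n → ℝ) ≃ᵃ[ℝ] (Fin n → ℝ)).linear v = 0 := by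
  have hν : ν₀ ∈ {x | x ∈ P.carrier ∧ ∀ γ ∈ Γ, γ x = x} := hfix ▸ rfl
  set F := ∑ γ : Γ, (γ : (Fin n → ℝ) ≃ᵃ[ℝ] (Fin n → ℝ)).linear v with hF
  have hinvF : ∀ δ ∈ Γ, δ.linear F = F := by
    intro δ hδ
    rw [hF, map_sum]
    exact Fintype.sum_equiv (Equiv.mulLeft (⟨δ, hδ⟩ : Γ)) _ _ fun γ => rfl
  -- F is fixed by all linear parts, so ν₀ + ε • F is a fixed point, and for small ε > 0 it lies in
  -- the open polytope; uniqueness forces F = 0.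
  have hc : Continuous fun ε : ℝ => ν₀ + ε • F := by fun_prop
  have h0 := hc.tendsto 0
  simp only [zero_smul, add_zero] at h0
  have h0' : Filter.Tendsto (fun ε : ℝ => ν₀ + ε • F) (𝓝[>] 0) (𝓝 ν₀) :=
    h0.mono_left nhdsWithin_le_nhds
  have hev := h0'.eventually_mem (isOpen_carrier.mem_nhds hν.1)
  obtain ⟨ε, hε, hε0⟩ := (hev.and self_mem_nhdsWithin).exists
  have hε0' : (0 : ℝ) < ε := hε0
  have h1 : ν₀ + ε • F ∈ {x | x ∈ P.carrier ∧ ∀ γ ∈ Γ, γ x = x} := by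
    refine ⟨hε, fun γ hγ => ?_⟩
    have := γ.map_vadd ν₀ (ε • F)
    simp only [vadd_eq_add] at this
    rw [add_comm, this, map_smul, hinvF γ hγ, hν.2 γ hγ]
  rw [hfix, Set.mem_singleton_iff, add_eq_left] at h1
  exact (smul_eq_zero.1 h1).resolve_left hε0'.ne'

/-- The vector with the given logarithmic coordinates. -/
def expVec (y : Fin n → ℝ) : Fin n → ℂ := fun i => (Real.exp (y i) : ℂ)

lemma expVec_ne_zero (y : Fin n → ℝ) (i : Fin n) : expVec y i ≠ 0 := by
  simp [expVec]

lemma norm_expVec (y : Fin n → ℝ) (i : Fin n) : ‖expVec y i‖ = Real.exp (y i) := by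
  simp only [expVec, Complex.norm_real, Real.norm_eq_abs, abs_of_pos (Real.exp_pos _)]

lemma expVec_zero : expVec (0 : Fin n → ℝ) = 1 := by ext i; simp [expVec]

lemma chart_expVec (e e' : P.ChartIndex) (y : Fin n → ℝ) :
    P.chart e (expVec y) = P.chart e' (expVec (logCoord e' (logVec e y))) := by
  rw [← chart_transition e e' (expVec_ne_zero y)]
  congr 1
  ext i
  simp only [transition, expVec, logCoord_logVec, Real.exp_sum]
  push_cast
  refine Finset.prod_congr rfl fun k _ => ?_
  rw [mul_comm, Complex.exp_int_mul]

/-- Polar decomposition of a vector with nonzero entries. -/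
lemma exists_polar {z : Fin n → ℂ} (hz : ∀ i, z i ≠ 0) :
    ∃ R : Fin n → Circle, z = (fun i => (R i : ℂ)) * expVec fun i => Real.log ‖z i‖ := by
  have h : ∀ i, z i / ‖z i‖ ∈ Submonoid.unitSphere ℂ := fun i => by
    refine mem_sphere_zero_iff_norm.2 ?_
    rw [norm_div, Complex.norm_real, norm_norm, div_self (norm_ne_zero_iff.2 (hz i))]
  refine ⟨fun i => ⟨z i / ‖z i‖, h i⟩, ?_⟩
  ext i
  have h1 : (‖z i‖ : ℂ) ≠ 0 := by exact_mod_cast norm_ne_zero_iff.2 (hz i)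
  simp only [Pi.mul_apply, expVec, Real.exp_log (norm_pos_iff.2 (hz i))]
  exact (div_mul_cancel₀ _ h1).symm

lemma IsRotation.mem_extendedTorus {φ : Equiv.Perm P.ToricManifold} {u : ι → Circle}
    (h : IsRotation φ u) (Γ : Subgroup ((Fin n → ℝ) ≃ᵃ[ℝ] (Fin n → ℝ))) :
    φ ∈ P.extendedTorus Γ :=
  Subgroup.subset_closure (Or.inl ⟨u, h⟩)

lemma IsInducedBy.mem_extendedTorus {φ : Equiv.Perm P.ToricManifold}
    {γ : (Fin n → ℝ) ≃ᵃ[ℝ] (Fin n → ℝ)} {π : Equiv.Perm ι} (h : IsInducedBy φ γ π)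
    {Γ : Subgroup ((Fin n → ℝ) ≃ᵃ[ℝ] (Fin n → ℝ))} (hγ : γ ∈ Γ) :
    φ ∈ P.extendedTorus Γ :=
  Subgroup.subset_closure (Or.inr ⟨γ, hγ, π, h.1, h.2⟩)

lemma apply_chart_rotate {Y : Type*} {Γ : Subgroup ((Fin n → ℝ) ≃ᵃ[ℝ] (Fin n → ℝ))}
    {f : P.ToricManifold → Y} (hf : ∀ φ ∈ P.extendedTorus Γ, ∀ x, f (φ x) = f x)
    (e : P.ChartIndex) (R : Fin n → Circle) (z : Fin n → ℂ) :
    f (P.chart e ((fun i => (R i : ℂ)) * z)) = f (P.chart e z) := by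
  obtain ⟨φ, u, hu, hφ⟩ := exists_isRotation_chart e R
  rw [← hφ, hf φ (hu.mem_extendedTorus Γ)]

/-- A rotation fixes the origin of the chart, so the constant in `log_normSq_sub_eq` is zero. -/
lemma normSq_rotate (ω₀ : KahlerMetric P.chart) (h : AnticanonicalMetric P.chart)
    (hω : ∀ e z, ω₀.coeff e z = -complexHessian (fun w => Real.log (h.normSq e w)) z)
    (Γ : Subgroup ((Fin n → ℝ) ≃ᵃ[ℝ] (Fin n → ℝ))) (hinv : ω₀.IsInvariant (P.extendedTorus Γ))
    (e : P.ChartIndex) {R : Fin n → ℂ} (hR : ∀ i, ‖R i‖ = 1) (z : Fin n → ℂ) :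
    h.normSq e (R * z) = h.normSq e z := by
  obtain ⟨φ, u, hu, hφ⟩ := exists_isRotation_chart e
    fun i => ⟨R i, mem_sphere_zero_iff_norm.2 (hR i)⟩
  have := log_normSq_sub_eq ω₀ h hω (hinv φ (hu.mem_extendedTorus Γ)) hu.permutesCharts hR hφ z
  rw [sub_self, sub_eq_zero] at this
  exact Real.log_injOn_pos (h.pos _ _) (h.pos _ _) this

/-- The local potential of the metric `ω₀ + i∂∂̄ψ`. -/
def localPotential (h : AnticanonicalMetric P.chart) (ψ : P.ToricManifold → ℝ) (e : P.ChartIndex)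
    (z : Fin n → ℂ) : ℝ := -Real.log (h.normSq e z) + ψ (P.chart e z)

/-- The potential of the metric `ω₀ + i∂∂̄ψ` on the open orbit. -/
def orbitPotential (h : AnticanonicalMetric P.chart) (ψ : P.ToricManifold → ℝ)
    (x : P.ToricManifold) : ℝ := -Real.log (sectionNormSq h x) + ψ x

/-- The linear term is log|z_1⋯z_n|². It preserves convexity and drops out of averages with
barycentre 0. -/
lemma orbitPotential_chart (h : AnticanonicalMetric P.chart) (ψ : P.ToricManifold → ℝ)
    (e : P.ChartIndex) (y : Fin n → ℝ) :
    orbitPotential h ψ (P.chart e (expVec y)) =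
      localPotential h ψ e (expVec y) - 2 * ∑ i, y i := by
  rw [orbitPotential, localPotential, sectionNormSq_chart, log_localNormSq h e (expVec_ne_zero y)]
  simp only [norm_expVec, Real.log_exp]
  ring

lemma orbitPotential_chart_one (h : AnticanonicalMetric P.chart) (ψ : P.ToricManifold → ℝ)
    (e : P.ChartIndex) : orbitPotential h ψ (P.chart e 1) = localPotential h ψ e 1 := by
  have := orbitPotential_chart h ψ e 0
  simpa [expVec_zero] using this

lemma smooth_localPotential (h : AnticanonicalMetric P.chart) {ψ : P.ToricManifold → ℝ}
    (hψ : IsSmooth P.chart ψ) (e : P.ChartIndex) : ContDiff ℝ ∞ (localPotential h ψ e) :=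
  (smooth_log_normSq h e).neg.add (hψ e)

section Invariant

variable {ν₀ : Fin n → ℝ} (hP : P.IsFanoWithCentre ν₀)
  {Γ : Subgroup ((Fin n → ℝ) ≃ᵃ[ℝ] (Fin n → ℝ))} (hΓ : ∀ γ ∈ Γ, P.IsSymmetry γ)
  (hfix : {x | x ∈ P.carrier ∧ ∀ γ ∈ Γ, γ x = x} = {ν₀})
  {ω₀ : KahlerMetric P.chart} {h : AnticanonicalMetric P.chart}
  (hω : ∀ e z, ω₀.coeff e z = -complexHessian (fun w => Real.log (h.normSq e w)) z)
  (hinv : ω₀.IsInvariant (P.extendedTorus Γ))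
  {ψ : P.ToricManifold → ℝ} (hψs : IsSmooth P.chart ψ)
  (hψi : ∀ φ ∈ P.extendedTorus Γ, ∀ x, ψ (φ x) = ψ x)
  (hψp : ∀ e z b, 0 ≤ levi (localPotential h ψ e) z b)

include hω hinv hψs hψi hψp in
lemma convexOn_localPotential (e : P.ChartIndex) :
    ConvexOn ℝ Set.univ fun y : Fin n → ℝ => localPotential h ψ e (expVec y) := by
  refine convexOn_comp_exp (smooth_localPotential h hψs e) (hψp e) fun R z hR => ?_
  have h1 := apply_chart_rotate hψi e (fun i => ⟨R i, mem_sphere_zero_iff_norm.2 (hR i)⟩) z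
  have h2 := normSq_rotate ω₀ h hω Γ hinv e hR z
  rw [localPotential, localPotential, h2]
  congr 1

include hP hΓ hfix hω hinv hψs hψi hψp in
/-- The invariant potential is minimal at the unit point of the open orbit. -/
lemma orbitPotential_chart_one_le [Finite Γ] (e : P.ChartIndex) (y : Fin n → ℝ) :
    orbitPotential h ψ (P.chart e 1) ≤ orbitPotential h ψ (P.chart e (expVec y)) := by
  have := Fintype.ofFinite Γ
  have hν : ν₀ ∈ {x | x ∈ P.carrier ∧ ∀ γ ∈ Γ, γ x = x} := hfix ▸ rfl
  -- The transformation induced by γ takes chart e to e' with the same coordinates, so the same y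
  -- read in e' gives the same value of the potential.
  have hact : ∀ γ : Γ, ∃ e' : P.ChartIndex,
      (∀ i x, pair (P.normal (idx e' i)) ((γ : (Fin n → ℝ) ≃ᵃ[ℝ] (Fin n → ℝ)).linear x) =
        pair (P.normal (idx e i)) x) ∧
      orbitPotential h ψ (P.chart e' (expVec y)) = orbitPotential h ψ (P.chart e (expVec y)) := by
    rintro ⟨γ, hγ⟩
    obtain ⟨π, hπ⟩ := exists_facet_perm hP (hΓ γ hγ).2 (hν.2 γ hγ)
    obtain ⟨φ, hφ⟩ := exists_isInducedBy (hΓ γ hγ) hπ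
    obtain ⟨e', he', hφe⟩ := exists_chart_of_isInducedBy hφ e
    refine ⟨e', fun i x => ?_, ?_⟩
    · have h1 := hπ (idx e i) (x + 0)
      have h2 := hπ (idx e i) 0
      have h3 := γ.map_vadd 0 x
      simp only [vadd_eq_add] at h3
      rw [h3, pair_add, pair_add] at h1
      rw [he']
      simp only at *
      linarith
    · rw [← hφe]
      have hmem := hφ.mem_extendedTorus hγ
      rw [orbitPotential, orbitPotential, hψi φ hmem,
        sectionNormSq_invariant ω₀ h hω Γ hinv hmem]
  choose e' he' hpot using hact
  -- These vectors are the images of `logVec e y` under the transposed inverse linear parts, which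
  -- sum to zero by `sum_linear_eq_zero`.
  have hsum : ∑ γ : Γ, logVec (e' γ) y = 0 := by
    ext j
    have h1 : ∀ γ : Γ, ∀ i, (P.normal (idx (e' γ) i) j : ℝ) = pair (P.normal (idx e i))
        (((γ⁻¹ : Γ) : (Fin n → ℝ) ≃ᵃ[ℝ] (Fin n → ℝ)).linear (Pi.single j 1)) := by
      intro γ i
      rw [← he' γ i]
      have : (γ : (Fin n → ℝ) ≃ᵃ[ℝ] (Fin n → ℝ)).linear
          (((γ⁻¹ : Γ) : (Fin n → ℝ) ≃ᵃ[ℝ] (Fin n → ℝ)).linear (Pi.single j 1)) =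
          (Pi.single j 1 : Fin n → ℝ) :=
        (γ : (Fin n → ℝ) ≃ᵃ[ℝ] (Fin n → ℝ)).linear.apply_symm_apply _
      rw [this]
      simp [pair, Pi.single_apply]
    have h2 : ∀ i, ∑ γ : Γ, pair (P.normal (idx e i))
        (((γ⁻¹ : Γ) : (Fin n → ℝ) ≃ᵃ[ℝ] (Fin n → ℝ)).linear (Pi.single j 1)) = 0 := by
      intro i
      have h3 : ∀ s : Finset Γ, ∑ γ ∈ s, pair (P.normal (idx e i))
          (((γ⁻¹ : Γ) : (Fin n → ℝ) ≃ᵃ[ℝ] (Fin n → ℝ)).linear (Pi.single j 1)) =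
          pair (P.normal (idx e i)) (∑ γ ∈ s,
            ((γ⁻¹ : Γ) : (Fin n → ℝ) ≃ᵃ[ℝ] (Fin n → ℝ)).linear (Pi.single j 1)) := by
        intro s
        classical
        induction s using Finset.induction_on with
        | empty => simp [pair]
        | insert a s ha ih => rw [Finset.sum_insert ha, Finset.sum_insert ha, pair_add, ih]
      have h4 : ∑ γ : Γ, ((γ⁻¹ : Γ) : (Fin n → ℝ) ≃ᵃ[ℝ] (Fin n → ℝ)).linear (Pi.single j 1) =
          ∑ γ : Γ, (γ : (Fin n → ℝ) ≃ᵃ[ℝ] (Fin n → ℝ)).linear (Pi.single j 1) :=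
        Fintype.sum_equiv (Equiv.inv Γ) _ _ fun γ => rfl
      rw [h3, h4, sum_linear_eq_zero hfix]
      simp [pair]
    simp only [Finset.sum_apply, logVec, h1, Pi.zero_apply]
    rw [Finset.sum_comm]
    simp only [← Finset.mul_sum, h2, mul_zero, Finset.sum_const_zero]
  -- The orbit of y seen in the fixed chart e: barycentre 0 and equal values of the orbit potential,
  -- ready for Jensen.
  set p : Γ → Fin n → ℝ := fun γ => logCoord e (logVec (e' γ) y)
  have hp : ∑ γ : Γ, p γ = 0 := by
    ext i
    simp only [p, Finset.sum_apply, logCoord, Pi.zero_apply]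
    rw [Finset.sum_comm]
    have : ∀ j, ∑ γ : Γ, logVec (e' γ) y j = 0 := fun j => by
      have := congrFun hsum j
      rwa [Finset.sum_apply] at this
    simp only [← Finset.sum_mul, this, zero_mul, Finset.sum_const_zero]
  have hconv := convexOn_localPotential hω hinv hψs hψi hψp e
  set N : ℝ := (Fintype.card Γ : ℝ)
  have hN : 0 < N := Nat.cast_pos.2 Fintype.card_pos
  have hJ := hconv.map_sum_le (t := Finset.univ) (w := fun _ : Γ => N⁻¹) (p := p)
    (fun _ _ => by positivity) (by simp [N]) (fun _ _ => Set.mem_univ _)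
  rw [← Finset.smul_sum, hp, smul_zero, expVec_zero, ← Finset.smul_sum, smul_eq_mul] at hJ
  have hval : ∀ γ, localPotential h ψ e (expVec (p γ)) =
      orbitPotential h ψ (P.chart e (expVec y)) + 2 * ∑ i, p γ i := by
    intro γ
    rw [← hpot γ, chart_expVec (e' γ) e y, orbitPotential_chart h ψ e (p γ)]
    ring
  simp only [hval, Finset.sum_add_distrib, Finset.sum_const, Finset.card_univ, nsmul_eq_mul,
    ← Finset.mul_sum] at hJ
  have hp' : ∑ γ : Γ, ∑ i, p γ i = 0 := by
    rw [Finset.sum_comm]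
    refine Finset.sum_eq_zero fun i _ => ?_
    have := congrFun hp i
    rwa [Finset.sum_apply] at this
  rw [hp', mul_zero, add_zero, ← mul_assoc, inv_mul_cancel₀ hN.ne', one_mul] at hJ
  rwa [orbitPotential_chart_one]

include hω hinv hψs hψi hψp in
/-- An upper bound for the invariant potentials. -/
lemma potential_le {C₀ : ℝ}
    (hC : ∀ e z, (∀ i, ‖z i‖ ≤ 1) → |Real.log (h.normSq e z)| ≤ C₀) (e₀ : P.ChartIndex)
    (x : P.ToricManifold) : ψ x ≤ orbitPotential h ψ (P.chart e₀ 1) + C₀ := by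
  obtain ⟨e, z, rfl⟩ := exists_eq_chart x
  refine le_of_forall_ne_zero (f := fun z => ψ (P.chart e z)) (hψs e).continuous ?_ z
  intro z hz
  obtain ⟨e', w, hw0, hw1, hzw, -⟩ := exists_polydisc e hz
  rw [hzw]
  obtain ⟨R, hR⟩ := exists_polar hw0
  set y : Fin n → ℝ := fun i => Real.log ‖w i‖
  have hy : ∀ i, y i ≤ 0 := fun i => Real.log_nonpos (norm_nonneg _) (hw1 i)
  rw [hR, apply_chart_rotate hψi e' R]
  have hconv := convexOn_localPotential hω hinv hψs hψi hψp e'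
  -- The local potential is smooth up to and across the divisor, hence bounded along the ray t • y,
  -- t ≥ 0, which stays in the polydisc. M depends on ψ but does not enter the conclusion.
  obtain ⟨M, -, hM⟩ := exists_bound_polydisc (P := P) (f := fun e => localPotential h ψ e)
    fun e => (smooth_localPotential h hψs e).continuous
  have hunit : ∀ t : ℝ, 0 ≤ t → ∀ i, ‖expVec (t • y) i‖ ≤ 1 := fun t ht i => by
    rw [norm_expVec]
    exact Real.exp_le_one_iff.2 (mul_nonpos_of_nonneg_of_nonpos ht (hy i))
  have h1 := ConvexOn.apply_le_of_ray_bounded hconv y (M := M) fun t ht =>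
    (le_abs_self _).trans (hM e' _ (hunit t ht))
  have h2 := hC e' (expVec y) (by simpa using hunit 1 zero_le_one)
  rw [expVec_zero, ← orbitPotential_chart_one, chart_one_eq e' e₀] at h1
  rw [localPotential] at h1
  have h3 := le_abs_self (Real.log (h.normSq e' (expVec y)))
  linarith

end Invariant

lemma levi_localPotential_pos {ω₀ : KahlerMetric P.chart} {h : AnticanonicalMetric P.chart}
    (hω : ∀ e z, ω₀.coeff e z = -complexHessian (fun w => Real.log (h.normSq e w)) z)
    {ψ : P.ToricManifold → ℝ} (hψs : IsSmooth P.chart ψ) (e : P.ChartIndex) (z : Fin n → ℂ) :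
    (ω₀.coeff e z + complexHessian (fun w => ψ (P.chart e w)) z).PosDef ↔
      ∀ b, b ≠ 0 → 0 < levi (localPotential h ψ e) z b := by
  rw [← posDef_complexHessian_iff (smooth_localPotential h hψs e), hω,
    ← complexHessian_neg (smooth_log_normSq h e),
    ← complexHessian_add (smooth_log_normSq h e).neg (hψs e)]
  rfl

lemma levi_zero_right {f : (Fin n → ℂ) → ℝ} (z : Fin n → ℂ) : levi f z 0 = 0 := by
  simp [levi, hess]

/-- The norm of the section decays at infinity in logarithmic coordinates. -/
lemma exists_log_localNormSq_le {h : AnticanonicalMetric P.chart} {C₀ : ℝ}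
    (hC : ∀ e z, (∀ i, ‖z i‖ ≤ 1) → |Real.log (h.normSq e z)| ≤ C₀) :
    ∃ a : ℝ, 0 < a ∧ ∀ (e : P.ChartIndex) (z : Fin n → ℂ), (∀ i, z i ≠ 0) →
      Real.log (localNormSq h e z) ≤ C₀ - a * ∑ i, |Real.log ‖z i‖| := by
  obtain ⟨K, hK⟩ := (Set.finite_range fun x : P.ChartIndex × ι × Fin n =>
    |(coords x.1 x.2.1 x.2.2 : ℝ)|).bddAbove
  have hK' : ∀ e r i, |(coords e r i : ℝ)| ≤ max K 0 := fun e r i =>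
    (hK ⟨(e, r, i), rfl⟩).trans (le_max_left _ _)
  -- D bounds the change of ∑|log| from the polydisc chart e' to e. In e' all logarithms are
  -- nonpositive, so log|s|² ≤ C₀ - 2∑|y'|, which gives the rate 2 / D.
  set D : ℝ := n * max K 0 + 1
  have hD : 0 < D := by positivity
  refine ⟨2 / D, by positivity, fun e z hz => ?_⟩
  obtain ⟨e', w, hw0, hw1, hzw, hlog⟩ := exists_polydisc e hz
  set y : Fin n → ℝ := fun i => Real.log ‖z i‖
  set y' : Fin n → ℝ := fun i => Real.log ‖w i‖
  have hy' : y' = logCoord e' (logVec e y) := funext hlog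
  have hy : y = logCoord e (logVec e' y') := by
    rw [hy', logVec_logCoord, logCoord_logVec_self]
  have h1 : ∀ i, |y i| ≤ max K 0 * ∑ k, |y' k| := by
    intro i
    rw [hy, logCoord_logVec]
    refine (Finset.abs_sum_le_sum_abs _ _).trans ?_
    rw [Finset.mul_sum]
    refine Finset.sum_le_sum fun k _ => ?_
    rw [abs_mul, mul_comm]
    exact mul_le_mul_of_nonneg_right (hK' _ _ _) (abs_nonneg _)
  have h2 : ∑ i, |y i| ≤ D * ∑ k, |y' k| := by
    refine (Finset.sum_le_sum fun i _ => h1 i).trans ?_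
    rw [Finset.sum_const, Finset.card_univ, Fintype.card_fin, nsmul_eq_mul, ← mul_assoc]
    refine mul_le_mul_of_nonneg_right (by simp [D]) (Finset.sum_nonneg fun _ _ => abs_nonneg _)
  have h3 : ∑ k, Real.log ‖w k‖ = -∑ k, |y' k| := by
    rw [← Finset.sum_neg_distrib]
    refine Finset.sum_congr rfl fun k _ => ?_
    rw [abs_of_nonpos (Real.log_nonpos (norm_nonneg _) (hw1 k)), neg_neg]
  rw [localNormSq_eq h hzw, log_localNormSq h e' hw0, h3]
  have h4 := (le_abs_self _).trans (hC e' w hw1)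
  have h5 : 2 / D * ∑ i, |y i| ≤ 2 * ∑ k, |y' k| := by
    rw [div_mul_eq_mul_div, div_le_iff₀ hD]
    linarith
  linarith

end DelzantPolytope

/-! ### An integrable weight in logarithmic coordinates -/

section Integrals

/-- The weight in one logarithmic variable. -/
def logWeight (s : ℝ) (x : ℝ) : ℝ := Real.exp (-s * |Real.log x|) / x ^ 2

/-- In polar coordinates the radial density is x^{s-1} on (0, 1] and x^{-s-1} beyond 1. -/
lemma integrable_logWeight {s : ℝ} (hs : 0 < s) : Integrable fun ζ : ℂ => logWeight s ‖ζ‖ := by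
  rw [integrable_fun_norm_addHaar volume (f := logWeight s), Complex.finrank_real_complex,
    ← Set.Ioc_union_Ioi_eq_Ioi zero_le_one]
  refine IntegrableOn.union ?_ ?_
  · have h1 := (intervalIntegrable_iff_integrableOn_Ioc_of_le zero_le_one).1
      (intervalIntegral.intervalIntegrable_rpow' (a := 0) (b := 1) (r := s - 1) (by linarith))
    refine h1.congr_fun (fun x hx => ?_) measurableSet_Ioc
    have hx0 : 0 < x := hx.1
    have : Real.exp (-s * |Real.log x|) = x ^ s := by
      rw [abs_of_nonpos (Real.log_nonpos hx0.le hx.2), Real.rpow_def_of_pos hx0]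
      congr 1; ring
    simp only [logWeight, this, Real.rpow_sub_one hx0.ne', smul_eq_mul]
    norm_num
    field_simp
  · have h1 := integrableOn_Ioi_rpow_of_lt (a := -s - 1) (c := 1) (by linarith) zero_lt_one
    refine h1.congr_fun (fun x hx => ?_) measurableSet_Ioi
    have hx1 : 1 < x := hx
    have hx0 : 0 < x := by linarith
    have : Real.exp (-s * |Real.log x|) = x ^ (-s) := by
      rw [abs_of_nonneg (Real.log_nonneg hx1.le), Real.rpow_def_of_pos hx0]
      congr 1; ring
    simp only [logWeight, this, Real.rpow_sub_one hx0.ne', smul_eq_mul]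
    norm_num
    field_simp

lemma integrable_prod_logWeight (n : ℕ) {s : ℝ} (hs : 0 < s) :
    Integrable fun z : Fin n → ℂ => ∏ i, logWeight s ‖z i‖ :=
  Integrable.fintype_prod (f := fun (_ : Fin n) (ζ : ℂ) => logWeight s ‖ζ‖)
    fun _ => integrable_logWeight hs

lemma ae_ne_zero (n : ℕ) : ∀ᵐ z : Fin n → ℂ, ∀ i, z i ≠ 0 := by
  rw [ae_all_iff]
  exact fun i => Measure.ae_eval_ne (fun _ : Fin n => (volume : Measure ℂ)) i 0

end Integrals

/-! ### Uniform integrability below the exponent 1 -/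

namespace DelzantPolytope

variable {n : ℕ} {ι : Type*} [Fintype ι] {P : DelzantPolytope n ι}

/-- An integral over `X` is bounded by the sum of the integrals over the charts. -/
lemma lintegral_volumeMeasure_le [Fintype P.ChartIndex] (ω₀ : KahlerMetric P.chart)
    (f : P.ToricManifold → ENNReal) :
    ∫⁻ x, f x ∂ω₀.volumeMeasure ≤ ∑ e : P.ChartIndex, ∫⁻ z : Fin n → ℂ,
      ENNReal.ofReal (2 ^ n * (ω₀.coeff e z).det.re) * f (P.chart e z) := by
  have hmeas : ∀ e, Measurable fun z : Fin n → ℂ =>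
      ENNReal.ofReal (2 ^ n * (ω₀.coeff e z).det.re) := by
    intro e
    have hc : Continuous fun z => ω₀.coeff e z :=
      continuous_pi fun i => continuous_pi fun j => (ω₀.smooth e i j).continuous
    exact (ENNReal.continuous_ofReal.comp (continuous_const.mul
      (Complex.continuous_re.comp hc.matrix_det))).measurable
  have h1 : ω₀.volumeMeasure ≤ Measure.sum fun e : P.ChartIndex => Measure.map (P.chart e)
      ((volume : Measure (Fin n → ℂ)).withDensity fun z =>
        ENNReal.ofReal (2 ^ n * (ω₀.coeff e z).det.re)) :=
    iSup_le fun e => Measure.le_sum _ e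
  refine (lintegral_mono' h1 le_rfl).trans ?_
  rw [lintegral_sum_measure, tsum_fintype]
  refine Finset.sum_le_sum fun e _ => (lintegral_map_le _ _).trans ?_
  exact lintegral_withDensity_le_lintegral_mul _ (hmeas e) _

section Invariant

variable {ν₀ : Fin n → ℝ} (hP : P.IsFanoWithCentre ν₀)
  {Γ : Subgroup ((Fin n → ℝ) ≃ᵃ[ℝ] (Fin n → ℝ))} (hΓ : ∀ γ ∈ Γ, P.IsSymmetry γ)
  (hfix : {x | x ∈ P.carrier ∧ ∀ γ ∈ Γ, γ x = x} = {ν₀})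
  {ω₀ : KahlerMetric P.chart} {h : AnticanonicalMetric P.chart}
  (hω : ∀ e z, ω₀.coeff e z = -complexHessian (fun w => Real.log (h.normSq e w)) z)
  (hinv : ω₀.IsInvariant (P.extendedTorus Γ))

include hP hΓ hfix hω hinv in
/-- A lower bound, on the open orbit, for all normalised invariant potentials. -/
lemma le_potential [Finite Γ] {ψ : P.ToricManifold → ℝ}
    (hψ : ψ ∈ normalizedPotentials ω₀ (P.extendedTorus Γ)) {C₀ : ℝ}
    (hC : ∀ e z, (∀ i, ‖z i‖ ≤ 1) → |Real.log (h.normSq e z)| ≤ C₀)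
    (e : P.ChartIndex) {z : Fin n → ℂ} (hz : ∀ i, z i ≠ 0) :
    -C₀ + Real.log (localNormSq h e z) ≤ ψ (P.chart e z) := by
  obtain ⟨hψs, hψi, hψp, ⟨x₀, hx₀⟩, -⟩ := hψ
  have hlevi : ∀ e z b, 0 ≤ levi (localPotential h ψ e) z b := by
    intro e z b
    by_cases hb : b = 0
    · rw [hb, levi_zero_right]
    · exact ((levi_localPotential_pos hω hψs e z).1 (hψp e z) b hb).le
  -- Applied where ψ attains its maximum 0, this bounds the minimum of the orbit potential below by
  -- -C₀.
  have h1 := potential_le hω hinv hψs hψi hlevi hC e x₀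
  rw [hx₀] at h1
  obtain ⟨R, hR⟩ := exists_polar hz
  set y : Fin n → ℝ := fun i => Real.log ‖z i‖
  have h2 := orbitPotential_chart_one_le hP hΓ hfix hω hinv hψs hψi hlevi e y
  have h3 : ψ (P.chart e z) = ψ (P.chart e (expVec y)) := by
    conv_lhs => rw [hR]
    exact apply_chart_rotate hψi e R _
  have h4 : localNormSq h e z = sectionNormSq h (P.chart e (expVec y)) := by
    rw [← sectionNormSq_chart]
    conv_lhs => rw [hR]
    exact apply_chart_rotate (fun φ hφ x => sectionNormSq_invariant ω₀ h hω Γ hinv hφ x) e R _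
  rw [orbitPotential, orbitPotential] at h2
  rw [orbitPotential] at h1
  rw [h3, h4]
  linarith

-- With e^{-βψ} at most a constant times |s|^{-2β} and density at most a constant times
-- |s|²/∏|z_i|², the integrand is dominated by |s|^{2(1-β)}/∏|z_i|²; the decay of |s|² turns this
-- into a product of weights `logWeight` with rate (1 - β)a > 0.
include hP hΓ hfix hω hinv in
lemma exists_lintegral_le [Finite Γ] {β : ℝ} (hβ0 : 0 ≤ β) (hβ1 : β < 1) :
    ∃ C : ℝ, ∀ ψ ∈ normalizedPotentials ω₀ (P.extendedTorus Γ),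
      ∫⁻ x, ENNReal.ofReal (Real.exp (-β * ψ x)) ∂ω₀.volumeMeasure ≤ ENNReal.ofReal C := by
  have := Fintype.ofFinite P.ChartIndex
  obtain ⟨C₀, hC₀, hC⟩ := exists_bound_polydisc (P := P)
    (f := fun e z => Real.log (h.normSq e z)) fun e => (smooth_log_normSq h e).continuous
  obtain ⟨a, ha, hdecay⟩ := exists_log_localNormSq_le hC
  obtain ⟨C₂, hC₂, hdet⟩ := exists_bound_polydisc (P := P)
    (f := fun e z => (ω₀.coeff e z).det.re / h.normSq e z) fun e => by
      have hc : Continuous fun z => ω₀.coeff e z :=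
        continuous_pi fun i => continuous_pi fun j => (ω₀.smooth e i j).continuous
      exact (Complex.continuous_re.comp hc.matrix_det).div (h.smooth e).continuous
        fun z => (h.pos e z).ne'
  have hdet' : ∀ (e : P.ChartIndex) (z : Fin n → ℂ), (∀ i, z i ≠ 0) →
      (ω₀.coeff e z).det.re ≤ C₂ * h.normSq e z := by
    intro e z hz
    obtain ⟨e', w, hw0, hw1, hzw, -⟩ := exists_polydisc e hz
    have h1 := det_coeff_ratio ω₀ h hz hzw
    have h2 := (le_abs_self _).trans (hdet e' w hw1)
    rw [← div_le_iff₀ (h.pos e z)]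
    refine le_trans (le_of_eq ?_) h2
    rw [div_eq_div_iff (h.pos e z).ne' (h.pos e' w).ne', h1]
  set s : ℝ := (1 - β) * a
  have hs : 0 < s := mul_pos (by linarith) ha
  -- The term β C₀ comes from the lower bound for ψ, the term (1 - β) C₀ from the decay estimate for
  -- |s|².
  set K : ℝ := 2 ^ n * C₂ * Real.exp (β * C₀ + (1 - β) * C₀)
  have hK : 0 ≤ K := by positivity
  have hpt : ∀ ψ ∈ normalizedPotentials ω₀ (P.extendedTorus Γ), ∀ (e : P.ChartIndex)
      (z : Fin n → ℂ), (∀ i, z i ≠ 0) →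
      ENNReal.ofReal (2 ^ n * (ω₀.coeff e z).det.re) *
        ENNReal.ofReal (Real.exp (-β * ψ (P.chart e z))) ≤
        ENNReal.ofReal (K * ∏ i, logWeight s ‖z i‖) := by
    intro ψ hψ e z hz
    rw [← ENNReal.ofReal_mul' (Real.exp_pos _).le]
    refine ENNReal.ofReal_le_ofReal ?_
    have h1 := le_potential hP hΓ hfix hω hinv hψ hC e hz
    set A := Real.log (localNormSq h e z) with hA
    have hprod : 0 < ∏ i, ‖z i‖ := Finset.prod_pos fun i _ => norm_pos_iff.2 (hz i)
    have hS : 0 < localNormSq h e z := mul_pos (pow_pos hprod 2) (h.pos e z)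
    have h2 : h.normSq e z = Real.exp A / (∏ i, ‖z i‖) ^ 2 := by
      rw [hA, Real.exp_log hS, localNormSq]
      field_simp
    have h3 : Real.exp (-β * ψ (P.chart e z)) ≤ Real.exp (β * C₀ - β * A) := by
      rw [Real.exp_le_exp]
      nlinarith [mul_le_mul_of_nonneg_left h1 hβ0]
    have h4 : (1 - β) * A ≤ (1 - β) * C₀ - s * ∑ i, |Real.log ‖z i‖| := by
      have := mul_le_mul_of_nonneg_left (hdecay e z hz) (sub_nonneg.2 hβ1.le)
      simp only [s]; linarith
    have h5 : ∏ i, logWeight s ‖z i‖ =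
        Real.exp (-(s * ∑ i, |Real.log ‖z i‖|)) / (∏ i, ‖z i‖) ^ 2 := by
      simp only [logWeight, Finset.prod_div_distrib, ← Finset.prod_pow, ← Real.exp_sum]
      congr 2
      rw [← Finset.mul_sum]; ring
    calc 2 ^ n * (ω₀.coeff e z).det.re * Real.exp (-β * ψ (P.chart e z))
        ≤ 2 ^ n * (C₂ * h.normSq e z) * Real.exp (β * C₀ - β * A) := by
          refine mul_le_mul ?_ h3 (Real.exp_pos _).le ?_
          · exact mul_le_mul_of_nonneg_left (hdet' e z hz) (by positivity)
          · have := h.pos e z; positivity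
      _ = 2 ^ n * C₂ / (∏ i, ‖z i‖) ^ 2 * Real.exp (β * C₀ + (1 - β) * A) := by
          rw [h2]
          have : Real.exp (β * C₀ + (1 - β) * A) = Real.exp A * Real.exp (β * C₀ - β * A) := by
            rw [← Real.exp_add]; congr 1; ring
          rw [this]; ring
      _ ≤ 2 ^ n * C₂ / (∏ i, ‖z i‖) ^ 2 *
          Real.exp (β * C₀ + ((1 - β) * C₀ - s * ∑ i, |Real.log ‖z i‖|)) := by
          refine mul_le_mul_of_nonneg_left ?_ (by positivity)
          rw [Real.exp_le_exp]; linarith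
      _ = K * ∏ i, logWeight s ‖z i‖ := by
          rw [h5]
          have : Real.exp (β * C₀ + ((1 - β) * C₀ - s * ∑ i, |Real.log ‖z i‖|)) =
              Real.exp (β * C₀ + (1 - β) * C₀) * Real.exp (-(s * ∑ i, |Real.log ‖z i‖|)) := by
            rw [← Real.exp_add]; congr 1; ring
          rw [this]; simp only [K]; ring
  have hint : ∫⁻ z : Fin n → ℂ, ENNReal.ofReal (K * ∏ i, logWeight s ‖z i‖) < ⊤ :=
    ((integrable_prod_logWeight n hs).const_mul K).lintegral_lt_top
  set B : ENNReal := ∑ _e : P.ChartIndex,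
    ∫⁻ z : Fin n → ℂ, ENNReal.ofReal (K * ∏ i, logWeight s ‖z i‖)
  have hB : B < ⊤ := ENNReal.sum_lt_top.2 fun _ _ => hint
  refine ⟨B.toReal, fun ψ hψ => ?_⟩
  rw [ENNReal.ofReal_toReal hB.ne]
  refine (lintegral_volumeMeasure_le ω₀ _).trans (Finset.sum_le_sum fun e _ => ?_)
  exact lintegral_mono_ae ((ae_ne_zero n).mono fun z hz => hpt ψ hψ e z hz)

end Invariant

end DelzantPolytope

/-! ### Test potentials and divergence above the exponent 1 -/

namespace DelzantPolytope

variable {n : ℕ} {ι : Type*} [Fintype ι] {P : DelzantPolytope n ι}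

lemma nonempty_chartIndex (P : DelzantPolytope n ι) : Nonempty P.ChartIndex :=
  ⟨(exists_logCoord_nonpos (P := P) 0).choose⟩

lemma localNormSq_eq_normSq_prod (h : AnticanonicalMetric P.chart) (e : P.ChartIndex)
    (z : Fin n → ℂ) :
    localNormSq h e z = Complex.normSq (∏ i, z i) * h.normSq e z := by
  rw [localNormSq, Complex.normSq_eq_norm_sq, norm_prod]

lemma localNormSq_nonneg (h : AnticanonicalMetric P.chart) (e : P.ChartIndex)
    (z : Fin n → ℂ) : 0 ≤ localNormSq h e z :=
  mul_nonneg (sq_nonneg _) (h.pos e z).le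

lemma sectionNormSq_nonneg (h : AnticanonicalMetric P.chart) (x : P.ToricManifold) :
    0 ≤ sectionNormSq h x := localNormSq_nonneg h _ _

lemma localNormSq_one (h : AnticanonicalMetric P.chart) (e : P.ChartIndex) :
    localNormSq h e 1 = h.normSq e 1 := by simp [localNormSq]

lemma contDiff_prod_coord : ContDiff ℂ ∞ fun z : Fin n → ℂ => ∏ i, z i :=
  contDiff_prod fun i _ => contDiff_apply ℂ ℂ i

lemma contDiff_normSq_prod_coord :
    ContDiff ℝ ∞ fun z : Fin n → ℂ => Complex.normSq (∏ i, z i) := by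
  have h1 : ContDiff ℝ ∞ fun z : Fin n → ℂ => ∏ i, z i :=
    contDiff_prod fun i _ => contDiff_apply ℝ ℂ i
  simp only [Complex.normSq_apply]
  exact ((Complex.reCLM.contDiff.comp h1).mul (Complex.reCLM.contDiff.comp h1)).add
    ((Complex.imCLM.contDiff.comp h1).mul (Complex.imCLM.contDiff.comp h1))

lemma smooth_localNormSq (h : AnticanonicalMetric P.chart) (e : P.ChartIndex) :
    ContDiff ℝ ∞ (localNormSq h e) := by
  have : localNormSq h e = fun z => Complex.normSq (∏ i, z i) * h.normSq e z :=
    funext (localNormSq_eq_normSq_prod h e)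
  rw [this]
  exact contDiff_normSq_prod_coord.mul (h.smooth e)

lemma continuous_sectionNormSq (h : AnticanonicalMetric P.chart) :
    Continuous (sectionNormSq h) := by
  refine continuous_of_comp_chart fun e => ?_
  simp only [sectionNormSq_chart]
  exact (smooth_localNormSq h e).continuous

/-- The potentials which concentrate along the toric divisor as `δ → 0`; here `m` is the maximum
of the norm of the invariant section. -/
def testPotential (h : AnticanonicalMetric P.chart) (m δ : ℝ) (x : P.ToricManifold) : ℝ :=
  Real.log (δ + sectionNormSq h x) - Real.log (δ + m)

/-- A lower bound for integrals over `X` by integrals over a chart. -/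
lemma le_lintegral_volumeMeasure (ω₀ : KahlerMetric P.chart) (e : P.ChartIndex)
    {f : P.ToricManifold → ENNReal} (hf : Measurable f) :
    ∫⁻ z : Fin n → ℂ, ENNReal.ofReal (2 ^ n * (ω₀.coeff e z).det.re) * f (P.chart e z) ≤
      ∫⁻ x, f x ∂ω₀.volumeMeasure := by
  have hmeas : Measurable fun z : Fin n → ℂ =>
      ENNReal.ofReal (2 ^ n * (ω₀.coeff e z).det.re) := by
    have hc : Continuous fun z => ω₀.coeff e z :=
      continuous_pi fun i => continuous_pi fun j => (ω₀.smooth e i j).continuous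
    exact (ENNReal.continuous_ofReal.comp (continuous_const.mul
      (Complex.continuous_re.comp hc.matrix_det))).measurable
  have hchart : Measurable (P.chart e) := (continuous_chart e).measurable
  have h1 : Measure.map (P.chart e) ((volume : Measure (Fin n → ℂ)).withDensity fun z =>
      ENNReal.ofReal (2 ^ n * (ω₀.coeff e z).det.re)) ≤ ω₀.volumeMeasure :=
    le_iSup (fun e => Measure.map (P.chart e) ((volume : Measure (Fin n → ℂ)).withDensity fun z =>
      ENNReal.ofReal (2 ^ n * (ω₀.coeff e z).det.re))) e
  refine le_trans (le_of_eq ?_) (lintegral_mono' h1 le_rfl)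
  rw [lintegral_map hf hchart]
  exact (lintegral_withDensity_eq_lintegral_mul _ hmeas (hf.comp hchart)).symm

section Invariant

variable {ν₀ : Fin n → ℝ} (hP : P.IsFanoWithCentre ν₀)
  {Γ : Subgroup ((Fin n → ℝ) ≃ᵃ[ℝ] (Fin n → ℝ))} (hΓ : ∀ γ ∈ Γ, P.IsSymmetry γ)
  (hfix : {x | x ∈ P.carrier ∧ ∀ γ ∈ Γ, γ x = x} = {ν₀})
  {ω₀ : KahlerMetric P.chart} {h : AnticanonicalMetric P.chart}
  (hω : ∀ e z, ω₀.coeff e z = -complexHessian (fun w => Real.log (h.normSq e w)) z)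
  (hinv : ω₀.IsInvariant (P.extendedTorus Γ))

include hω in
lemma levi_neg_log_normSq_pos (e : P.ChartIndex) (z b : Fin n → ℂ) (hb : b ≠ 0) :
    0 < levi (fun w => -Real.log (h.normSq e w)) z b := by
  have h1 := ω₀.posDef e z
  rw [hω, ← complexHessian_neg (smooth_log_normSq h e),
    posDef_complexHessian_iff (smooth_log_normSq h e).neg] at h1
  exact h1 b hb

-- The minimum principle for ψ = 0 puts the maximum of |s|² at the unit point; off the open orbit s
-- vanishes.
include hP hΓ hfix hω hinv in
lemma sectionNormSq_le [Finite Γ] (e₀ : P.ChartIndex) (x : P.ToricManifold) :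
    sectionNormSq h x ≤ h.normSq e₀ 1 := by
  obtain ⟨e, z, rfl⟩ := exists_eq_chart x
  have hone : sectionNormSq h (P.chart e 1) = h.normSq e₀ 1 := by
    rw [chart_one_eq e e₀, sectionNormSq_chart, localNormSq_one]
  by_cases hz : ∀ i, z i ≠ 0
  · obtain ⟨R, hR⟩ := exists_polar hz
    have h1 : sectionNormSq h (P.chart e z) =
        sectionNormSq h (P.chart e (expVec fun i => Real.log ‖z i‖)) := by
      conv_lhs => rw [hR]
      exact apply_chart_rotate (fun φ hφ x => sectionNormSq_invariant ω₀ h hω Γ hinv hφ x) e R _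
    have h2 := orbitPotential_chart_one_le hP hΓ hfix hω hinv (ψ := fun _ => 0)
      (fun _ => contDiff_const) (fun _ _ _ => rfl) (fun e z b => by
        have h3 : localPotential h (fun _ => 0) e = fun w => -Real.log (h.normSq e w) := by
          ext w; simp [localPotential]
        rw [h3]
        by_cases hb : b = 0
        · rw [hb, levi_zero_right]
        · exact (levi_neg_log_normSq_pos hω e z b hb).le) e fun i => Real.log ‖z i‖
    simp only [orbitPotential, add_zero, neg_le_neg_iff, ← h1, hone] at h2
    have h3 : 0 < sectionNormSq h (P.chart e z) := by
      rw [sectionNormSq_chart]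
      exact mul_pos (pow_pos (Finset.prod_pos fun i _ => norm_pos_iff.2 (hz i)) 2) (h.pos e z)
    exact (Real.log_le_log_iff h3 (h.pos _ _)).1 h2
  · push Not at hz
    obtain ⟨i, hi⟩ := hz
    rw [sectionNormSq_chart, localNormSq_eq_normSq_prod,
      Finset.prod_eq_zero (Finset.mem_univ i) hi]
    simpa using (h.pos e₀ 1).le

include hP hΓ hfix hω hinv in
lemma testPotential_mem [Finite Γ] (e₀ : P.ChartIndex) {δ : ℝ} (hδ : 0 < δ) :
    testPotential h (h.normSq e₀ 1) δ ∈ normalizedPotentials ω₀ (P.extendedTorus Γ) := by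
  have hpos : ∀ e z, 0 < δ + localNormSq h e z := fun e z =>
    add_pos_of_pos_of_nonneg hδ (localNormSq_nonneg h e z)
  have hsm : IsSmooth P.chart (testPotential h (h.normSq e₀ 1) δ) := by
    intro e
    simp only [testPotential, sectionNormSq_chart]
    exact ((contDiff_const.add (smooth_localNormSq h e)).log fun z => (hpos e z).ne').sub
      contDiff_const
  refine ⟨hsm, fun φ hφ x => ?_, fun e z => ?_, ⟨P.chart e₀ 1, ?_⟩, ?_⟩
  · simp only [testPotential, sectionNormSq_invariant ω₀ h hω Γ hinv hφ]
  · rw [levi_localPotential_pos hω hsm]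
    intro b hb
    set u : (Fin n → ℂ) → ℝ := fun w => -Real.log (h.normSq e w)
    have hu : ContDiff ℝ ∞ u := (smooth_log_normSq h e).neg
    have hexp : ∀ w, Real.exp (u w) = (h.normSq e w)⁻¹ := fun w => by
      rw [Real.exp_neg, Real.exp_log (h.pos e w)]
    have hG : ContDiff ℝ ∞ fun w : Fin n → ℂ =>
        Real.log (δ * Real.exp (u w) + Complex.normSq (∏ i, w i)) := by
      refine ((contDiff_const.mul hu.exp).add contDiff_normSq_prod_coord).log fun w => ?_
      have := Complex.normSq_nonneg (∏ i, w i)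
      positivity
    -- Dividing δ + |s|² by the metric gives δeᵘ + |z_1⋯z_n|², with u strictly plurisubharmonic and
    -- the product holomorphic: the situation of `levi_log_pos`.
    have heq : localPotential h (testPotential h (h.normSq e₀ 1) δ) e = fun w =>
        Real.log (δ * Real.exp (u w) + Complex.normSq (∏ i, w i)) +
          -Real.log (δ + h.normSq e₀ 1) := by
      ext w
      have h1 : δ * Real.exp (u w) + Complex.normSq (∏ i, w i) =
          (δ + localNormSq h e w) / h.normSq e w := by
        rw [hexp, localNormSq_eq_normSq_prod]
        have := (h.pos e w).ne'
        field_simp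
      rw [h1, Real.log_div (hpos e w).ne' (h.pos e w).ne', localPotential, testPotential,
        sectionNormSq_chart]
      ring
    rw [heq, levi_add hG contDiff_const]
    have h0 : levi (fun _ : Fin n → ℂ => -Real.log (δ + h.normSq e₀ 1)) z b = 0 := by
      simp [levi, hess]
    rw [h0, add_zero]
    exact levi_log_pos hu contDiff_prod_coord hδ hG z b (levi_neg_log_normSq_pos hω e z b hb)
  · simp only [testPotential, sectionNormSq_chart, localNormSq_one, sub_self]
  · rintro _ ⟨x, rfl⟩
    have h1 := sectionNormSq_le hP hΓ hfix hω hinv e₀ x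
    have h2 := sectionNormSq_nonneg h x
    exact sub_nonpos.2 (Real.log_le_log (by linarith) (by linarith))

-- On the polydisc with one radius √δ and the others 1, of volume δπⁿ, the test potential is at most
-- log δ plus a constant. The integral is thus at least a constant times δ^{1-β}, unbounded as δ → 0
-- when β > 1. A distinguished coordinate exists because n > 0.
include hP hΓ hfix hω hinv in
lemma le_one_of_lintegral_le [Finite Γ] (hn : 0 < n) {β C : ℝ}
    (hC : ∀ ψ ∈ normalizedPotentials ω₀ (P.extendedTorus Γ),
      ∫⁻ x, ENNReal.ofReal (Real.exp (-β * ψ x)) ∂ω₀.volumeMeasure ≤ ENNReal.ofReal C) :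
    β ≤ 1 := by
  by_contra hβ
  push Not at hβ
  obtain ⟨e⟩ := nonempty_chartIndex P
  obtain ⟨H, hH0, hH⟩ := exists_bound_polydisc (P := P) (f := fun e z => h.normSq e z)
    fun e => (h.smooth e).continuous
  have hdetpos : ∀ e z, 0 < (ω₀.coeff e z).det.re := fun e z =>
    (Complex.lt_def.1 (ω₀.posDef e z).det_pos).1
  obtain ⟨M, hM0, hM⟩ := exists_bound_polydisc (P := P)
    (f := fun e z => ((ω₀.coeff e z).det.re)⁻¹) fun e => by
      have hc : Continuous fun z => ω₀.coeff e z :=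
        continuous_pi fun i => continuous_pi fun j => (ω₀.smooth e i j).continuous
      exact (Complex.continuous_re.comp hc.matrix_det).inv₀ fun z => (hdetpos e z).ne'
  have hMdet : ∀ z : Fin n → ℂ, (∀ i, ‖z i‖ ≤ 1) → (M + 1)⁻¹ ≤ (ω₀.coeff e z).det.re := by
    intro z hz
    have h1 := (le_abs_self _).trans (hM e z hz)
    rw [inv_le_comm₀ (by linarith) (hdetpos e z)]
    linarith
  set m : ℝ := h.normSq e 1
  have hm : 0 < m := h.pos e 1
  set k : ℝ := 2 ^ n * (M + 1)⁻¹ * Real.exp (β * (Real.log m - Real.log (1 + H))) * Real.pi ^ n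
  have hM1 : 0 < M + 1 := by linarith
  have hk : 0 < k := by positivity
  let i₀ : Fin n := ⟨0, hn⟩
  -- With δ = e^{-τ}. `ENNReal.ofReal` sends a negative C to 0, hence `max C 0`.
  have key : ∀ τ : ℝ, 0 ≤ τ → k * Real.exp ((β - 1) * τ) ≤ max C 0 := by
    intro τ hτ
    set δ : ℝ := Real.exp (-τ)
    have hδ : 0 < δ := Real.exp_pos _
    have hmem := testPotential_mem hP hΓ hfix hω hinv e hδ
    have h1 := hC _ hmem
    have hmeas : Measurable fun x : P.ToricManifold =>
        ENNReal.ofReal (Real.exp (-β * testPotential h m δ x)) := by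
      have : Continuous (testPotential h m δ) := by
        refine Continuous.sub (Continuous.log (continuous_const.add (continuous_sectionNormSq h))
          fun x => ?_) continuous_const
        exact (add_pos_of_pos_of_nonneg hδ (sectionNormSq_nonneg h x)).ne'
      exact (ENNReal.continuous_ofReal.comp
        (Real.continuous_exp.comp (continuous_const.mul this))).measurable
    have h2 := (le_lintegral_volumeMeasure ω₀ e hmeas).trans h1
    set rad : Fin n → ℝ := fun i => if i = i₀ then Real.exp (-τ / 2) else 1
    set B : Set (Fin n → ℂ) := Set.univ.pi fun i => Metric.closedBall 0 (rad i)
    have hrad0 : ∀ i, 0 ≤ rad i := fun i => by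
      simp only [rad]; split_ifs <;> positivity
    have hrad1 : ∀ i, rad i ≤ 1 := fun i => by
      simp only [rad]; split_ifs
      · exact Real.exp_le_one_iff.2 (by linarith)
      · exact le_rfl
    have hradprod : ∏ i, rad i = Real.exp (-τ / 2) := by simp [rad]
    have hsq : Real.exp (-τ / 2) ^ 2 = δ := by
      rw [← Real.exp_nat_mul]; congr 1; push_cast; ring
    have hvol : volume B = ENNReal.ofReal (δ * Real.pi ^ n) := by
      rw [volume_pi_pi]
      have : ∀ i, volume (Metric.closedBall (0 : ℂ) (rad i)) =
          ENNReal.ofReal (rad i ^ 2 * Real.pi) := by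
        intro i
        rw [Complex.volume_closedBall, ENNReal.ofReal_mul (sq_nonneg _),
          ENNReal.ofReal_pow (hrad0 i)]
        congr 1
        rw [← NNReal.coe_real_pi, ENNReal.ofReal_coe_nnreal]
      simp only [this]
      rw [← ENNReal.ofReal_prod_of_nonneg fun i _ => by positivity]
      congr 1
      rw [Finset.prod_mul_distrib, Finset.prod_pow, hradprod, hsq]
      simp
    set c : ℝ := 2 ^ n * (M + 1)⁻¹ *
      Real.exp (β * (Real.log m - Real.log (1 + H)) + β * τ)
    have hB : MeasurableSet B :=
      MeasurableSet.univ_pi fun i => Metric.isClosed_closedBall.measurableSet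
    have h3 : ENNReal.ofReal c * volume B ≤ ENNReal.ofReal C := by
      rw [← setLIntegral_const]
      refine le_trans ((setLIntegral_mono' hB fun z hz => ?_).trans
        (setLIntegral_le_lintegral B _)) h2
      have hz1 : ∀ i, ‖z i‖ ≤ rad i := fun i => by
        have := hz i (Set.mem_univ i)
        rwa [mem_closedBall_zero_iff] at this
      have hz2 : ∀ i, ‖z i‖ ≤ 1 := fun i => (hz1 i).trans (hrad1 i)
      rw [← ENNReal.ofReal_mul' (Real.exp_pos _).le]
      refine ENNReal.ofReal_le_ofReal ?_
      have hS : localNormSq h e z ≤ δ * H := by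
        rw [localNormSq]
        refine mul_le_mul ?_ ((le_abs_self _).trans (hH e z hz2)) (h.pos e z).le hδ.le
        rw [← hsq, ← hradprod]
        exact pow_le_pow_left₀ (Finset.prod_nonneg fun i _ => norm_nonneg _)
          (Finset.prod_le_prod (fun i _ => norm_nonneg _) fun i _ => hz1 i) 2
      have hψ : testPotential h m δ (P.chart e z) ≤ -τ + Real.log (1 + H) - Real.log m := by
        rw [testPotential, sectionNormSq_chart]
        have h4 : Real.log (δ + localNormSq h e z) ≤ -τ + Real.log (1 + H) := by
          have : Real.log (δ * (1 + H)) = -τ + Real.log (1 + H) := by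
            rw [Real.log_mul hδ.ne' (by positivity), Real.log_exp]
          rw [← this]
          exact Real.log_le_log (add_pos_of_pos_of_nonneg hδ (localNormSq_nonneg h e z))
            (by linarith)
        have h5 : Real.log m ≤ Real.log (δ + m) := Real.log_le_log hm (by linarith)
        linarith
      refine mul_le_mul ?_ ?_ (Real.exp_pos _).le (by have := hdetpos e z; positivity)
      · exact mul_le_mul_of_nonneg_left (hMdet z hz2) (by positivity)
      · rw [Real.exp_le_exp]
        nlinarith
    rw [hvol, ← ENNReal.ofReal_mul (by positivity)] at h3
    have h6 : c * (δ * Real.pi ^ n) = k * Real.exp ((β - 1) * τ) := by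
      have : Real.exp (β * (Real.log m - Real.log (1 + H)) + β * τ) * δ =
          Real.exp (β * (Real.log m - Real.log (1 + H))) * Real.exp ((β - 1) * τ) := by
        rw [← Real.exp_add, ← Real.exp_add]; congr 1; ring
      simp only [c, k]
      linear_combination (2 ^ n * (M + 1)⁻¹ * Real.pi ^ n) * this
    rw [h6] at h3
    exact (ENNReal.ofReal_le_ofReal_iff (le_max_right C 0)).1
      (h3.trans (ENNReal.ofReal_le_ofReal (le_max_left C 0)))
  have hβ' : 0 < β - 1 := by linarith
  have hmax : 0 ≤ max C 0 := le_max_right C 0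
  -- This τ makes the exponent equal to max C 0 / k; then e^x ≥ x + 1 yields max C 0 + k ≤ max C 0,
  -- against k > 0.
  have h7 := key (max C 0 / k / (β - 1)) (by positivity)
  rw [mul_div_cancel₀ _ hβ'.ne'] at h7
  have h8 := Real.add_one_le_exp (max C 0 / k)
  have h9 := mul_le_mul_of_nonneg_left h8 hk.le
  rw [mul_add, mul_div_cancel₀ _ hk.ne'] at h9
  linarith

end Invariant

end DelzantPolytope

end ToricAlpha

end

theorem mainTheorem6 {n : ℕ} (hn : 0 < n) {ι : Type*} [Fintype ι]
    (P : ToricAlpha.DelzantPolytope n ι) (ν₀ : Fin n → ℝ) (hP : P.IsFanoWithCentre ν₀)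
    (Γ : Subgroup ((Fin n → ℝ) ≃ᵃ[ℝ] (Fin n → ℝ))) [Finite Γ]
    (hΓ : ∀ γ ∈ Γ, P.IsSymmetry γ)
    (hfix : {x | x ∈ P.carrier ∧ ∀ γ ∈ Γ, γ x = x} = {ν₀})
    (ω₀ : ToricAlpha.KahlerMetric P.chart)
    (hinv : ω₀.IsInvariant (P.extendedTorus Γ))
    (hclass : ω₀.IsAnticanonical) :
    ToricAlpha.alphaInvariant ω₀ (P.extendedTorus Γ) = 1 := by
  obtain ⟨h, hω⟩ := hclass
  refine le_antisymm (sSup_le ?_) (le_of_forall_lt fun c hc => ?_)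
  · rintro _ ⟨β, ⟨C, hC⟩, rfl⟩
    have := ToricAlpha.DelzantPolytope.le_one_of_lintegral_le hP hΓ hfix hω hinv hn hC
    exact EReal.coe_le_coe_iff.2 this
  · obtain ⟨β, hβ, hβ1⟩ := EReal.lt_iff_exists_real_btwn.1 (max_lt hc zero_lt_one)
    have h0 : 0 ≤ β := by exact_mod_cast ((le_max_right c 0).trans hβ.le)
    have h1 : β < 1 := by exact_mod_cast hβ1
    have hmem := ToricAlpha.DelzantPolytope.exists_lintegral_le hP hΓ hfix hω hinv h0 h1
    exact ((le_max_left c 0).trans_lt hβ).trans_le (le_sSup ⟨β, hmem, rfl⟩)
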